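/- Let $(V,0)\subset(\mathbb{C}^n,0)$ be a reduced complex analytic curve germ with local ring $\mathcal{O}_V=\mathbb{C}\{x_1,\dots,x_n\}/I$ ($I$ a radical ideal, $\dim\mathcal{O}_V=1$). Let $M\subset\mathcal{O}_V^p$ be a submodule whose rank at the generic point of each irreducible component of $(V,0)$ is $e$, and let $[M]$ be a $p\times c$ matrix whose columns generate $M$, i.e. a presentation matrix of $\mathcal{O}_V^p/M$. For $A\in\mathrm{Mat}(e\times p,\mathbb{C})$ let $M_e=A\cdot M\subset F:=\mathcal{O}_V^e$ be the submodule generated by the columns of $A[M]$. Denote by $F^l$ the $l$-th graded component of $\mathrm{Sym}(F)$, and by $M_e^l\subset F^l$ the $l$-th graded component of the Rees algebra $\mathcal{R}(M_e)$, the subalgebra of $\mathrm{Sym}(F)$ generated by $M_e$ placed in degree $1$. When the quotients below are finite dimensional over $\mathbb{C}$, the Buchsbaum–Rim multiplicity of $(M_e,F)$ is the number $e(M_e,F)$ with $$\dim_{\mathbb{C}}F^l/M_e^l=e(M_e,F)\,\frac{l^e}{e!}+O(l^{e-1})\qquad(l\to\infty),$$ and the Hilbert–Samuel multiplicity of an ideal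 $J\subset\mathcal{O}_V$ is the number $e(J)$ with $$\dim_{\mathbb{C}}\mathcal{O}_V/J^l=e(J)\,l+O(1)\qquad(l\to\infty).$$ Let $\mathrm{Fitt}_{p-e}(\mathcal{O}_V^p/M)$ be the Fitting ideal generated by the $e\times e$ minors of $[M]$. Then its Hilbert–Samuel multiplicity exists and is a nonnegative integer and, for generic $A$ (that is, for all $A$ in some nonempty Zariski open subset of $\mathrm{Mat}(e\times p,\mathbb{C})$), the module $M_e$ has rank $e$ at the generic point of each irreducible component of $(V,0)$, the Buchsbaum–Rim multiplicity of $(M_e,F)$ exists, and $$e(M_e,F)=e\big(\mathrm{Fitt}_{p-e}(\mathcal{O}_V^p/M)\big).$$ -/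

import Mathlib

open Filter Asymptotics

/-- A formal power series `∑ aₘ xᵐ` in `n` variables over `ℂ` is convergent if it converges
absolutely on some polydisc `|x₁|, …, |xₙ| ≤ r` with `r > 0`. -/
def IsConvergentSeries {n : ℕ} (f : MvPowerSeries (Fin n) ℂ) : Prop :=
  ∃ r : ℝ, 0 < r ∧ Summable fun m : Fin n →₀ ℕ => ‖MvPowerSeries.coeff m f‖ * r ^ m.degree

theorem summable_coeff_of_le {n : ℕ} (h : MvPowerSeries (Fin n) ℂ) {a b : ℝ} (hb : 0 < b)
    (hba : b ≤ a) (hs : Summable fun m : Fin n →₀ ℕ => ‖MvPowerSeries.coeff m h‖ * a ^ m.degree) :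
    Summable fun m : Fin n →₀ ℕ => ‖MvPowerSeries.coeff m h‖ * b ^ m.degree :=
  Summable.of_nonneg_of_le (fun _ => mul_nonneg (norm_nonneg _) (pow_nonneg hb.le _))
    (fun _ => mul_le_mul_of_nonneg_left (pow_le_pow_left₀ hb.le hba _) (norm_nonneg _)) hs

theorem norm_coeff_mul_le {n : ℕ} (f g : MvPowerSeries (Fin n) ℂ) {t : ℝ} (ht : 0 < t)
    (m : Fin n →₀ ℕ) :
    ‖MvPowerSeries.coeff m (f * g)‖ * t ^ m.degree ≤
      ∑ q ∈ Finset.HasAntidiagonal.antidiagonal m,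
        (‖MvPowerSeries.coeff q.1 f‖ * t ^ q.1.degree) *
          (‖MvPowerSeries.coeff q.2 g‖ * t ^ q.2.degree) := by
  have h1 : ‖MvPowerSeries.coeff m (f * g)‖ ≤ ∑ q ∈ Finset.HasAntidiagonal.antidiagonal m,
      ‖MvPowerSeries.coeff q.1 f‖ * ‖MvPowerSeries.coeff q.2 g‖ := by
    rw [MvPowerSeries.coeff_mul]
    exact (norm_sum_le _ _).trans (le_of_eq (Finset.sum_congr rfl fun q _ => norm_mul _ _))
  refine (mul_le_mul_of_nonneg_right h1 (pow_nonneg ht.le _)).trans (le_of_eq ?_)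
  rw [Finset.sum_mul]
  refine Finset.sum_congr rfl fun q hq => ?_
  have h : m = q.1 + q.2 := (Finset.HasAntidiagonal.mem_antidiagonal.1 hq).symm
  have h' : m.degree = q.1.degree + q.2.degree := by rw [h, map_add]
  rw [h', pow_add]
  ring

theorem summable_antidiagonal {n : ℕ} {F G : (Fin n →₀ ℕ) → ℝ} (hF : Summable F)
    (hG : Summable G) (hF0 : 0 ≤ F) (hG0 : 0 ≤ G) :
    Summable fun m => ∑ q ∈ Finset.HasAntidiagonal.antidiagonal m, F q.1 * G q.2 :=
  summable_sum_mul_antidiagonal_of_summable_mul (Summable.mul_of_nonneg hF hG hF0 hG0)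

theorem isConvergentSeries_mul {n : ℕ} {f g : MvPowerSeries (Fin n) ℂ}
    (hf : IsConvergentSeries f) (hg : IsConvergentSeries g) : IsConvergentSeries (f * g) := by
  obtain ⟨r, hr, hf⟩ := hf
  obtain ⟨s, hs, hg⟩ := hg
  obtain ⟨t, ht, htr, hts⟩ : ∃ t : ℝ, 0 < t ∧ t ≤ r ∧ t ≤ s :=
    ⟨min r s, lt_min hr hs, min_le_left _ _, min_le_right _ _⟩
  have h3 := (summable_antidiagonal (summable_coeff_of_le f ht htr hf)
    (summable_coeff_of_le g ht hts hg)
    (fun m => mul_nonneg (norm_nonneg _) (pow_nonneg ht.le _))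
    (fun m => mul_nonneg (norm_nonneg _) (pow_nonneg ht.le _)))
  refine ⟨t, ht, ?_⟩
  exact Summable.of_nonneg_of_le
    (fun m => mul_nonneg (norm_nonneg _) (pow_nonneg ht.le _)) (norm_coeff_mul_le f g ht) h3

theorem isConvergentSeries_add {n : ℕ} {f g : MvPowerSeries (Fin n) ℂ}
    (hf : IsConvergentSeries f) (hg : IsConvergentSeries g) : IsConvergentSeries (f + g) := by
  obtain ⟨r, hr, hf⟩ := hf
  obtain ⟨s, hs, hg⟩ := hg
  obtain ⟨t, ht, htr, hts⟩ : ∃ t : ℝ, 0 < t ∧ t ≤ r ∧ t ≤ s :=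
    ⟨min r s, lt_min hr hs, min_le_left _ _, min_le_right _ _⟩
  refine ⟨t, ht, Summable.of_nonneg_of_le
    (fun m => mul_nonneg (norm_nonneg _) (pow_nonneg ht.le _)) (fun m => ?_)
    ((summable_coeff_of_le f ht htr hf).add (summable_coeff_of_le g ht hts hg))⟩
  rw [map_add, ← add_mul]
  exact mul_le_mul_of_nonneg_right (norm_add_le _ _) (pow_nonneg ht.le _)

theorem isConvergentSeries_algebraMap {n : ℕ} (c : ℂ) :
    IsConvergentSeries (algebraMap ℂ (MvPowerSeries (Fin n) ℂ) c) := by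
  refine ⟨1, one_pos, summable_of_ne_finset_zero (s := {0}) fun m hm => ?_⟩
  have hm' : m ≠ 0 := by simpa using hm
  classical
  simp [MvPowerSeries.algebraMap_apply, MvPowerSeries.coeff_C, hm']

/-- The ring `ℂ{x₁, …, xₙ}` of convergent power series, i.e. the local ring `𝒪_{ℂⁿ,0}` of germs of
holomorphic functions at the origin. -/
def ConvergentPowerSeries (n : ℕ) : Subalgebra ℂ (MvPowerSeries (Fin n) ℂ) where
  carrier := {f | IsConvergentSeries f}
  mul_mem' := isConvergentSeries_mul
  add_mem' := isConvergentSeries_add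
  algebraMap_mem' := isConvergentSeries_algebraMap

/-- The quotient `ℂ{x₁, …, xₙ} / I`: for a radical ideal `I`, the local ring `𝒪_{V,0}` of the germ
at the origin of the reduced complex analytic subvariety `V ⊆ ℂⁿ` defined by `I`. -/
def LocalAnalyticRing (n : ℕ) (I : Ideal (ConvergentPowerSeries n)) : Type :=
  ConvergentPowerSeries n ⧸ I

noncomputable instance (n : ℕ) (I : Ideal (ConvergentPowerSeries n)) :
    CommRing (LocalAnalyticRing n I) :=
  inferInstanceAs (CommRing (ConvergentPowerSeries n ⧸ I))

noncomputable instance (n : ℕ) (I : Ideal (ConvergentPowerSeries n)) :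
    Algebra ℂ (LocalAnalyticRing n I) :=
  inferInstanceAs (Algebra ℂ (ConvergentPowerSeries n ⧸ I))

section Multiplicities

variable {R : Type*} [CommRing R]

/-- The `R`-module `M` has generic rank `e`: at the generic point of every irreducible component of
`Spec R`, i.e. after localizing at any minimal prime, its rank is `e`.  (For reduced `R` these
localizations are fields.) -/
def HasGenericRank (R : Type*) [CommRing R] (M : Type*) [AddCommGroup M] [Module R M] (e : ℕ) :
    Prop :=
  ∀ (P : Ideal R) [P.IsPrime], P ∈ minimalPrimes R →
    Module.rank (Localization.AtPrime P) (LocalizedModule P.primeCompl M) = e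

/-- The ideal generated by the `s × s` minors of a presentation matrix of `R^p / M`, that is, of
a matrix whose columns generate `M ⊆ R^p`.  By multilinearity of the determinant this is the ideal
generated by the `s × s` minors of all matrices with columns `v 0, …, v (s - 1)` in `M`; `r` chooses
the rows. -/
def minorsIdeal {p : ℕ} (M : Submodule R (Fin p → R)) (s : ℕ) : Ideal R :=
  Ideal.span {x | ∃ (v : Fin s → M) (r : Fin s → Fin p),
    x = Matrix.det (Matrix.of fun i j => (v j : Fin p → R) (r i))}

/-- The `k`-th Fitting ideal `Fitt_k (R^p / M)`, generated by the minors of size `p - k` of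
a presentation matrix of `R^p / M`.  (The unit ideal if `k ≥ p`, as usual.) -/
def fittingIdealOfQuotient {p : ℕ} (M : Submodule R (Fin p → R)) (k : ℕ) : Ideal R :=
  minorsIdeal M (p - k)

/-- The Rees algebra of a submodule `N ⊆ F`: the subalgebra of `Sym F` generated by `N` placed in
degree one. -/
def reesAlgebraOfSubmodule {F : Type*} [AddCommGroup F] [Module R F] (N : Submodule R F) :
    Subalgebra R (SymmetricAlgebra R F) :=
  Algebra.adjoin R (SymmetricAlgebra.ι R F '' N)

/-- The `l`-th graded component `N^l ⊆ Sym^l F` of the Rees algebra of a submodule `N ⊆ F`, spanned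
by the `l`-fold products of elements of `N`.  For `N = ⊤` this is `F^l = Sym^l F`. -/
def reesComponent {F : Type*} [AddCommGroup F] [Module R F] (N : Submodule R F) (l : ℕ) :
    Submodule R (SymmetricAlgebra R F) :=
  (N.map (SymmetricAlgebra.ι R F)) ^ l

/-- The Rees algebra is the sum of its graded components. -/
theorem iSup_reesComponent {F : Type*} [AddCommGroup F] [Module R F] (N : Submodule R F) :
    ⨆ l, reesComponent N l = (reesAlgebraOfSubmodule N).toSubmodule := by
  apply le_antisymm
  · refine iSup_le fun l => ?_
    have h : N.map (SymmetricAlgebra.ι R F) ≤ (reesAlgebraOfSubmodule N).toSubmodule := by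
      rintro _ ⟨x, hx, rfl⟩
      exact Algebra.subset_adjoin ⟨x, hx, rfl⟩
    unfold reesComponent
    induction l with
    | zero => simp [Submodule.one_le]
    | succ l ih =>
      rw [pow_succ]
      exact Submodule.mul_le.2 fun a ha b hb =>
        (reesAlgebraOfSubmodule N).mul_mem (ih ha) (h hb)
  · intro x hx
    rw [reesAlgebraOfSubmodule, Algebra.adjoin_eq_span] at hx
    refine (Submodule.span_le.2 ?_) hx
    intro y hy
    have : ∃ l, y ∈ reesComponent N l := by
      induction hy using Submonoid.closure_induction with
      | mem z hz =>
        refine ⟨1, ?_⟩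
        obtain ⟨w, hw, rfl⟩ := hz
        simpa [reesComponent] using ⟨w, hw, rfl⟩
      | one => exact ⟨0, by simp [reesComponent]⟩
      | mul a b _ _ ha hb =>
        obtain ⟨i, hi⟩ := ha
        obtain ⟨j, hj⟩ := hb
        refine ⟨i + j, ?_⟩
        unfold reesComponent at *
        rw [pow_add]
        exact Submodule.mul_mem_mul hi hj
    obtain ⟨l, hl⟩ := this
    exact Submodule.mem_iSup_of_mem l hl

/-- The quotient `F^l / N^l` of the graded components of `Sym F` and of the Rees algebra of
`N ⊆ F`. -/
abbrev ReesQuotient {F : Type*} [AddCommGroup F] [Module R F] (N : Submodule R F) (l : ℕ) : Type _ :=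
  (reesComponent (⊤ : Submodule R F) l) ⧸
    (reesComponent N l).submoduleOf (reesComponent (⊤ : Submodule R F) l)

variable [Algebra ℂ R]

/-- `k` is the Hilbert–Samuel multiplicity of the ideal `I` in a `d`-dimensional ring `R`:
all `R / I^l` are finite dimensional over `ℂ`, and
`dim_ℂ (R / I^l) = k l^d / d! + O(l^(d-1))`. -/
def IsHilbertSamuelMultiplicity (d : ℕ) (I : Ideal R) (k : ℕ) : Prop :=
  (∀ l, Module.Finite ℂ (R ⧸ I ^ l)) ∧
  (fun l : ℕ => (Module.finrank ℂ (R ⧸ I ^ l) : ℝ) - k * (l : ℝ) ^ d / d.factorial)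
    =O[atTop] fun l : ℕ => (l : ℝ) ^ ((d : ℤ) - 1)

/-- `k` is the Buchsbaum–Rim multiplicity `e(N, F)` of the pair `N ⊆ F = R^e`, for `R` of
dimension one: all `F^l / N^l` are finite dimensional over `ℂ`, and
`dim_ℂ (F^l / N^l) = k l^e / e! + O(l^(e-1))`. -/
def IsBuchsbaumRimMultiplicity {e : ℕ} (N : Submodule R (Fin e → R)) (k : ℕ) : Prop :=
  (∀ l, Module.Finite ℂ (ReesQuotient N l)) ∧
  (fun l : ℕ => (Module.finrank ℂ (ReesQuotient N l) : ℝ) - k * (l : ℝ) ^ e / e.factorial)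
    =O[atTop] fun l : ℕ => (l : ℝ) ^ ((e : ℤ) - 1)

/-- The submodule `A · M ⊆ R^e` obtained from `M ⊆ R^p` and a matrix `A ∈ Mat(e × p, ℂ)`: if the
columns of `[M]` generate `M`, it is generated by the columns of `A [M]`. -/
def matrixImage {e p : ℕ} (A : Matrix (Fin e) (Fin p) ℂ) (M : Submodule R (Fin p → R)) :
    Submodule R (Fin e → R) :=
  M.map (A.map (algebraMap ℂ R)).mulVecLin

end Multiplicities

/-- A property holds for a generic matrix in `Mat(e × p, ℂ)`: it holds on a nonempty Zariski open
set, equivalently, off the zero locus of a nonzero polynomial in the entries. -/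
def ForGenericMatrix {e p : ℕ} (Φ : Matrix (Fin e) (Fin p) ℂ → Prop) : Prop :=
  ∃ P : MvPolynomial (Fin e × Fin p) ℂ, P ≠ 0 ∧
    ∀ A : Matrix (Fin e) (Fin p) ℂ, MvPolynomial.eval (fun ij => A ij.1 ij.2) P ≠ 0 → Φ A

/-- Two numbers `a, b` with `u l = a l^d / d! + O(l^(d-1)) = b l^d / d! + O(l^(d-1))` agree. -/
theorem leadingCoefficient_unique {u : ℕ → ℝ} {d a b : ℕ}
    (ha : (fun l : ℕ => u l - a * (l : ℝ) ^ d / d.factorial)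
      =O[atTop] fun l : ℕ => (l : ℝ) ^ ((d : ℤ) - 1))
    (hb : (fun l : ℕ => u l - b * (l : ℝ) ^ d / d.factorial)
      =O[atTop] fun l : ℕ => (l : ℝ) ^ ((d : ℤ) - 1)) : a = b := by
  have h := hb.sub ha
  have hlit : (fun l : ℕ => (l : ℝ) ^ ((d : ℤ) - 1)) =o[atTop] fun l : ℕ => (l : ℝ) ^ d := by
    rw [isLittleO_iff_tendsto']
    · have : Tendsto (fun l : ℕ => ((l : ℝ))⁻¹) atTop (nhds 0) := tendsto_inv_atTop_nhds_zero_nat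
      refine this.congr' ?_
      filter_upwards [eventually_ge_atTop 1] with l hl
      have : (l : ℝ) ≠ 0 := by positivity
      rw [zpow_sub₀ this, zpow_natCast, zpow_one]
      field_simp
    · filter_upwards [eventually_ge_atTop 1] with l hl h0
      have : (l : ℝ) ^ d ≠ 0 := by positivity
      exact absurd h0 this
  have h2 := h.trans_isLittleO hlit
  have h3 := h2.tendsto_div_nhds_zero
  have h4 : Tendsto (fun _ : ℕ => ((a : ℝ) - b) / d.factorial) atTop (nhds 0) := by
    refine h3.congr' ?_
    filter_upwards [eventually_ge_atTop 1] with l hl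
    have : (l : ℝ) ≠ 0 := by positivity
    field_simp
    ring
  have h5 := tendsto_nhds_unique h4 tendsto_const_nhds
  have h6 : (d.factorial : ℝ) ≠ 0 := by positivity
  have h7 : (a : ℝ) - b = 0 := by
    have := h5.symm
    rwa [div_eq_zero_iff, or_iff_left h6] at this
  exact_mod_cast sub_eq_zero.1 h7

/-- The Hilbert–Samuel multiplicity is unique. -/
theorem IsHilbertSamuelMultiplicity.unique {R : Type*} [CommRing R] [Algebra ℂ R] {d : ℕ}
    {I : Ideal R} {a b : ℕ} (ha : IsHilbertSamuelMultiplicity d I a)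
    (hb : IsHilbertSamuelMultiplicity d I b) : a = b :=
  leadingCoefficient_unique ha.2 hb.2

/-- The Buchsbaum–Rim multiplicity is unique. -/
theorem IsBuchsbaumRimMultiplicity.unique {R : Type*} [CommRing R] [Algebra ℂ R] {e : ℕ}
    {N : Submodule R (Fin e → R)} {a b : ℕ} (ha : IsBuchsbaumRimMultiplicity N a)
    (hb : IsBuchsbaumRimMultiplicity N b) : a = b :=
  leadingCoefficient_unique ha.2 hb.2

/-! Write `R` for the local ring of the curve, `X` for a matrix of generators of `M`, and `J` for
the ideal of `e × e` minors of `X`. Generic rank `e` says that `J` lies in no minimal prime, so `J`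
contains a nonzerodivisor. Both multiplicities turn out to be the length of `R / (det Φ)`, where `Φ
= A X B` is a square matrix with columns in `M_e`, `A` is generic and `B` is a fixed constant
matrix.

The determinant of `A X B` is a linear combination of the minors of `X` (Cauchy–Binet), general
enough to generate a reduction of `J`: there is one nonzerodivisor `c`, independent of `A` and `l`,
with `c Jˡ ⊆ (det Φ)ˡ` (`exists_generic_minor`). To see this, adjoin to `R` the quotients of the
generators of `J` by some principal reduction `d`. This gives a finite `R`-algebra `S` in which `J`
becomes principal; a combination of the generators still generates `J S` unless its coefficients
satisfy one of finitely many linear equations, one for each maximal ideal of `S`. The conductor-like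
element `c` satisfies `c S ⊆ R`.

Since `c Jˡ ⊆ (det Φ)ˡ ⊆ Jˡ`, the length of `R / Jˡ` is `l · length R/(det Φ)` up to a bounded
error. For modules, Cramer's rule gives `c M_eˡ ⊆ (im Φ)ˡ ⊆ M_eˡ` (`smul_mem_formsOf_range`), so
replacing `M_e` by `im Φ` costs at most the length of `Fˡ / c Fˡ`, which is `O(l^(e-1))`.

It remains to find the length of `Fˡ / (im Φ)ˡ`. It is additive in products of matrices, hence
determined by `det Φ` (`eq_comp_det_of_diagonal`), and scalar matrices give the constant: `e` times
this length is `e.multichoose l * l * length R/(det Φ)`, whose leading term is the required one.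

The algebra uses only that `R` is a reduced one-dimensional Noetherian local ring with residue field
`ℂ`. That `ℂ{x₁, …, xₙ}` is Noetherian and local follows from a division theorem with convergence
estimates. -/

/-! ### Prime codes as a monomial order, and division of convergent power series -/

/-- The exponent `m` encoded as the natural number `∏ pᵢ ^ mᵢ`, with `pᵢ` the `i`-th prime. -/
noncomputable def primeCode {n : ℕ} (m : Fin n →₀ ℕ) : ℕ :=
  ∏ i : Fin n, (Nat.nth Nat.Prime i) ^ m i

theorem primeCode_zero {n : ℕ} : primeCode (0 : Fin n →₀ ℕ) = 1 := by
  simp [primeCode]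

theorem primeCode_add {n : ℕ} (a b : Fin n →₀ ℕ) :
    primeCode (a + b) = primeCode a * primeCode b := by
  simp [primeCode, pow_add, Finset.prod_mul_distrib]

theorem primeCode_pos {n : ℕ} (m : Fin n →₀ ℕ) : 0 < primeCode m :=
  Finset.prod_pos fun i _ => pow_pos (Nat.prime_nth_prime i).pos _

/-- Unique factorization. Being injective and multiplicative, the codes order the exponents totally
and compatibly with addition, with finite initial segments. -/
theorem primeCode_injective {n : ℕ} : Function.Injective (primeCode (n := n)) := by
  have key : ∀ (m : Fin n →₀ ℕ) (j : Fin n),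
      (primeCode m).factorization (Nat.nth Nat.Prime j) = m j := by
    intro m j
    unfold primeCode
    rw [Nat.factorization_prod fun (i : Fin n) _ =>
      (pow_pos (Nat.prime_nth_prime i).pos (m i)).ne']
    rw [Finsupp.finsetSum_apply, Finset.sum_eq_single j]
    · simp
    · intro i _ hij
      have : Nat.nth Nat.Prime i ≠ Nat.nth Nat.Prime j := fun h =>
        hij (Fin.ext (Nat.nth_injective Nat.infinite_setOfPred_prime h))
      simp [this]
    · simp
  intro a b h
  ext j
  rw [← key a j, ← key b j, h]

theorem two_pow_le_primeCode {n : ℕ} (m : Fin n →₀ ℕ) : 2 ^ m.degree ≤ primeCode m := by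
  rw [Finsupp.degree_eq_sum, ← Finset.prod_pow_eq_pow_sum]
  exact Finset.prod_le_prod' fun i _ => Nat.pow_le_pow_left (Nat.prime_nth_prime i).two_le _

theorem exists_primeCode_le_pow (n : ℕ) :
    ∃ P : ℕ, 0 < P ∧ ∀ m : Fin n →₀ ℕ, primeCode m ≤ P ^ m.degree := by
  refine ⟨Nat.nth Nat.Prime n, (Nat.prime_nth_prime n).pos, fun m => ?_⟩
  rw [Finsupp.degree_eq_sum, ← Finset.prod_pow_eq_pow_sum]
  exact Finset.prod_le_prod' fun i _ => Nat.pow_le_pow_left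
    ((Nat.nth_strictMono Nat.infinite_setOfPred_prime).monotone i.2.le) _

theorem finite_primeCode_lt {n : ℕ} (k : ℕ) : {m : Fin n →₀ ℕ | primeCode m < k}.Finite :=
  Set.Finite.preimage primeCode_injective.injOn (Set.finite_lt_nat k)

/-- The weight of the exponent `m` in the norm with parameter `s`. -/
noncomputable def codeWeight {n : ℕ} (s : ℕ) (m : Fin n →₀ ℕ) : ℝ := ((primeCode m : ℝ) ^ s)⁻¹

theorem codeWeight_pos {n : ℕ} (s : ℕ) (m : Fin n →₀ ℕ) : 0 < codeWeight s m :=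
  inv_pos.2 (pow_pos (Nat.cast_pos.2 (primeCode_pos m)) _)

theorem codeWeight_add {n : ℕ} (s : ℕ) (a b : Fin n →₀ ℕ) :
    codeWeight s (a + b) = codeWeight s a * codeWeight s b := by
  simp [codeWeight, primeCode_add, mul_pow, mul_comm]

theorem codeWeight_anti {n : ℕ} {s s' : ℕ} (h : s ≤ s') (m : Fin n →₀ ℕ) :
    codeWeight s' m ≤ codeWeight s m := by
  have h1 : (1 : ℝ) ≤ primeCode m := Nat.one_le_cast.2 (primeCode_pos m)
  exact inv_anti₀ (pow_pos (by positivity) _) (pow_le_pow_right₀ h1 h)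

theorem summable_codeWeight_of_le {n : ℕ} {a : (Fin n →₀ ℕ) → ℂ} {s s' : ℕ} (h : s ≤ s')
    (hs : Summable fun m => ‖a m‖ * codeWeight s m) :
    Summable fun m => ‖a m‖ * codeWeight s' m :=
  Summable.of_nonneg_of_le (fun _ => mul_nonneg (norm_nonneg _) (codeWeight_pos _ _).le)
    (fun m => mul_le_mul_of_nonneg_left (codeWeight_anti h m) (norm_nonneg _)) hs

/-- The code of `m` lies between `2 ^ deg m` and `P ^ deg m`, so the weights `code⁻ˢ` and `r ^ deg`
dominate each other after adjusting the parameters. The code weights are multiplicative and also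
decrease along the monomial order, which the division needs. -/
theorem isConvergentSeries_iff_codeWeight {n : ℕ} (f : MvPowerSeries (Fin n) ℂ) :
    IsConvergentSeries f ↔
      ∃ s : ℕ, Summable fun m => ‖MvPowerSeries.coeff m f‖ * codeWeight s m := by
  constructor
  · rintro ⟨r, hr, h⟩
    obtain ⟨s, hs⟩ := exists_pow_lt_of_lt_one hr (show (2⁻¹ : ℝ) < 1 by norm_num)
    refine ⟨s, Summable.of_nonneg_of_le
      (fun _ => mul_nonneg (norm_nonneg _) (codeWeight_pos _ _).le) (fun m => ?_) h⟩
    refine mul_le_mul_of_nonneg_left ?_ (norm_nonneg _)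
    calc codeWeight s m ≤ (((2 : ℝ) ^ m.degree) ^ s)⁻¹ := by
          refine inv_anti₀ (by positivity) (pow_le_pow_left₀ (by positivity) ?_ _)
          exact_mod_cast two_pow_le_primeCode m
      _ = ((2⁻¹ : ℝ) ^ s) ^ m.degree := by
          rw [← inv_pow, ← inv_pow, ← pow_mul, ← pow_mul, mul_comm]
      _ ≤ r ^ m.degree := pow_le_pow_left₀ (by positivity) hs.le _
  · rintro ⟨s, h⟩
    obtain ⟨P, hP, hle⟩ := exists_primeCode_le_pow n
    refine ⟨((P : ℝ) ^ s)⁻¹, by positivity, Summable.of_nonneg_of_le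
      (fun _ => by positivity) (fun m => ?_) h⟩
    refine mul_le_mul_of_nonneg_left ?_ (norm_nonneg _)
    have h1 : (primeCode m : ℝ) ≤ (P : ℝ) ^ m.degree := by exact_mod_cast hle m
    have h0 : (0 : ℝ) < primeCode m := Nat.cast_pos.2 (primeCode_pos m)
    calc (((P : ℝ) ^ s)⁻¹) ^ m.degree = (((P : ℝ) ^ m.degree) ^ s)⁻¹ := by
          rw [inv_pow, ← pow_mul, ← pow_mul, mul_comm]
      _ ≤ codeWeight s m := inv_anti₀ (pow_pos h0 _) (pow_le_pow_left₀ h0.le h1 _)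

/-- The terms beyond the exponent `m₀` are dominated by the weight of `m₀`. -/
theorem exists_tail_le {n : ℕ} {a : (Fin n →₀ ℕ) → ℂ} {s₀ : ℕ} (m₀ : Fin n →₀ ℕ)
    (hs : Summable fun m => ‖a m‖ * codeWeight s₀ m)
    (ha : ∀ m, a m ≠ 0 → primeCode m₀ < primeCode m) :
    ∃ s₁, s₀ ≤ s₁ ∧ ∀ s, s₁ ≤ s → ∑' m, ‖a m‖ * codeWeight s m ≤ codeWeight s m₀ / 2 := by
  set K := ∑' m, ‖a m‖ * codeWeight s₀ m with hK
  set c : ℝ := (primeCode m₀ : ℝ) with hc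
  have hc0 : 0 < c := Nat.cast_pos.2 (primeCode_pos m₀)
  -- Codes are integers, so exponents of the tail have code at least `c + 1`. Raising the parameter
  -- by `k` shrinks the tail by at least `(c + 1)ᵏ` and the weight of `m₀` only by `cᵏ`.
  have hlim : Tendsto (fun k : ℕ => (K * c ^ s₀) * (c / (c + 1)) ^ k) atTop (nhds 0) := by
    have := (tendsto_pow_atTop_nhds_zero_of_lt_one (r := c / (c + 1)) (by positivity)
      (by rw [div_lt_one (by positivity)]; linarith)).const_mul (K * c ^ s₀)
    simpa using this
  obtain ⟨k₁, hk₁⟩ := eventually_atTop.1 (hlim.eventually_lt_const (show (0 : ℝ) < 1 / 2 by norm_num))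
  refine ⟨s₀ + k₁, Nat.le_add_right _ _, fun s hs1 => ?_⟩
  obtain ⟨k, rfl⟩ := Nat.exists_eq_add_of_le (le_trans (Nat.le_add_right _ _) hs1)
  have hk : k₁ ≤ k := by omega
  have hterm : ∀ m, ‖a m‖ * codeWeight (s₀ + k) m ≤
      (‖a m‖ * codeWeight s₀ m) * ((c + 1) ^ k)⁻¹ := by
    intro m
    by_cases h0 : a m = 0
    · simp [h0]
    have h1 : c + 1 ≤ primeCode m := by rw [hc]; exact_mod_cast ha m h0
    have : codeWeight (s₀ + k) m ≤ codeWeight s₀ m * ((c + 1) ^ k)⁻¹ := by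
      unfold codeWeight
      rw [pow_add, mul_inv]
      refine mul_le_mul_of_nonneg_left ?_ (by positivity)
      exact inv_anti₀ (by positivity) (pow_le_pow_left₀ (by positivity) h1 _)
    rw [mul_assoc]
    exact mul_le_mul_of_nonneg_left this (norm_nonneg _)
  calc ∑' m, ‖a m‖ * codeWeight (s₀ + k) m
      ≤ ∑' m, (‖a m‖ * codeWeight s₀ m) * ((c + 1) ^ k)⁻¹ :=
        (summable_codeWeight_of_le (Nat.le_add_right _ _) hs).tsum_le_tsum hterm
          (hs.mul_right _)
    _ = K * ((c + 1) ^ k)⁻¹ := by rw [tsum_mul_right]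
    _ ≤ codeWeight (s₀ + k) m₀ / 2 := by
        have := (hk₁ k hk).le
        unfold codeWeight
        rw [← hc, pow_add]
        rw [div_pow] at this
        have h2 : K * ((c + 1) ^ k)⁻¹ = ((K * c ^ s₀) * (c ^ k / (c + 1) ^ k)) *
            (c ^ s₀ * c ^ k)⁻¹ := by
          field_simp
        rw [h2]
        have h3 : 0 ≤ (c ^ s₀ * c ^ k)⁻¹ := by positivity
        nlinarith

/-- A triangular linear system with small off-diagonal part has an absolutely summable solution. -/
theorem exists_summable_solution {ι : Type*} (N : ι → ℕ) (hN : ∀ k, {m | N m < k}.Finite)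
    (t : ι → ι → ℂ) (w : ι → ℝ) (hw : ∀ m, 0 < w m)
    (hsum : ∀ m, Summable fun m' => ‖t m m'‖ * w m')
    (hle : ∀ m, ∑' m', ‖t m m'‖ * w m' ≤ w m / 2) (g : ι → ℂ)
    (hg : Summable fun m => ‖g m‖ * w m) :
    ∃ h : ι → ℂ, (∀ m', g m' = h m' + ∑ m ∈ (hN (N m')).toFinset, h m * t m m') ∧
      Summable fun m => ‖h m‖ * w m := by
  classical
  let F : (m' : ι) → ((m : ι) → N m < N m' → ℂ) → ℂ := fun m' ih =>
    g m' - ∑ m ∈ (hN (N m')).toFinset.attach,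
      ih m.1 ((hN (N m')).mem_toFinset.1 m.2) * t m.1 m'
  let h : ι → ℂ := (measure N).wf.fix F
  have hh : ∀ m', h m' = g m' - ∑ m ∈ (hN (N m')).toFinset, h m * t m m' := by
    intro m'
    have := (measure N).wf.fix_eq F m'
    change h m' = _ at this
    rw [this]
    change g m' - ∑ m ∈ (hN (N m')).toFinset.attach, h m.1 * t m.1 m' = _
    rw [Finset.sum_attach _ (fun m => h m * t m m')]
  refine ⟨h, fun m' => by rw [hh m']; ring, ?_⟩
  set G := ∑' m, ‖g m‖ * w m
  -- On an initial segment the off-diagonal part contributes at most half of the sum to be bounded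
  -- and is absorbed. Only finite sums occur, so summability of `h` is not presupposed.
  have hbound : ∀ X : ℕ, ∑ m ∈ (hN X).toFinset, ‖h m‖ * w m ≤ 2 * G := by
    intro X
    set S := (hN X).toFinset
    have h1 : ∀ m' ∈ S, ‖h m'‖ * w m' ≤ ‖g m'‖ * w m' + ∑ m ∈ S, ‖h m‖ * (‖t m m'‖ * w m') := by
      intro m' hm'
      have hsub : (hN (N m')).toFinset ⊆ S := by
        intro m hm
        simp only [S, Set.Finite.mem_toFinset, Set.mem_ofPred_eq] at hm hm' ⊢
        omega
      have : ‖h m'‖ ≤ ‖g m'‖ + ∑ m ∈ S, ‖h m‖ * ‖t m m'‖ := by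
        rw [hh m']
        refine (norm_sub_le _ _).trans (add_le_add_right ?_ _)
        refine (norm_sum_le _ _).trans ?_
        simp_rw [norm_mul]
        exact Finset.sum_le_sum_of_subset_of_nonneg hsub fun _ _ _ => by positivity
      calc ‖h m'‖ * w m' ≤ (‖g m'‖ + ∑ m ∈ S, ‖h m‖ * ‖t m m'‖) * w m' :=
            mul_le_mul_of_nonneg_right this (hw m').le
        _ = _ := by rw [add_mul, Finset.sum_mul]; simp_rw [mul_assoc]
    have h2 : ∑ m' ∈ S, ‖h m'‖ * w m' ≤
        ∑ m' ∈ S, ‖g m'‖ * w m' + ∑ m ∈ S, ‖h m‖ * ∑ m' ∈ S, ‖t m m'‖ * w m' := by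
      refine (Finset.sum_le_sum h1).trans (le_of_eq ?_)
      rw [Finset.sum_add_distrib, Finset.sum_comm]
      simp_rw [Finset.mul_sum]
    have h3 : ∑ m' ∈ S, ‖g m'‖ * w m' ≤ G :=
      hg.sum_le_tsum _ fun m _ => mul_nonneg (norm_nonneg _) (hw m).le
    have h4 : ∑ m ∈ S, ‖h m‖ * ∑ m' ∈ S, ‖t m m'‖ * w m' ≤ ∑ m ∈ S, (‖h m‖ * w m) / 2 := by
      refine Finset.sum_le_sum fun m _ => ?_
      have : ∑ m' ∈ S, ‖t m m'‖ * w m' ≤ w m / 2 :=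
        ((hsum m).sum_le_tsum _ fun m' _ => mul_nonneg (norm_nonneg _) (hw m').le).trans (hle m)
      rw [mul_div_assoc]
      exact mul_le_mul_of_nonneg_left this (norm_nonneg _)
    rw [← Finset.sum_div] at h4
    linarith
  refine summable_of_sum_le (c := 2 * G) (fun m => mul_nonneg (norm_nonneg _) (hw m).le) fun u => ?_
  have hsub : u ⊆ (hN (u.sup N + 1)).toFinset := by
    intro m hm
    simp only [Set.Finite.mem_toFinset, Set.mem_ofPred_eq]
    exact Nat.lt_succ_of_le (Finset.le_sup hm)
  exact (Finset.sum_le_sum_of_subset_of_nonneg hsub fun m _ _ =>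
    mul_nonneg (norm_nonneg _) (hw m).le).trans (hbound _)

/-- Weierstrass–Grauert–Hironaka division: `g = ∑ qᵢ fᵢ + r`, with no exponent of `r` divisible by
one of the leading exponents `aᵢ` of the convergent series `fᵢ`. -/
theorem exists_convergent_division {n : ℕ} {κ : Type*} [Fintype κ]
    (f : κ → MvPowerSeries (Fin n) ℂ) (a : κ → (Fin n →₀ ℕ))
    (hf : ∀ i, IsConvergentSeries (f i)) (hlead : ∀ i, MvPowerSeries.coeff (a i) (f i) = 1)
    (hmin : ∀ i m, MvPowerSeries.coeff m (f i) ≠ 0 → m ≠ a i → primeCode (a i) < primeCode m)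
    (g : MvPowerSeries (Fin n) ℂ) (hg : IsConvergentSeries g) :
    ∃ (q : κ → MvPowerSeries (Fin n) ℂ) (r : MvPowerSeries (Fin n) ℂ),
      (∀ i, IsConvergentSeries (q i)) ∧ IsConvergentSeries r ∧
      (∀ m, MvPowerSeries.coeff m r ≠ 0 → ∀ i, ¬ a i ≤ m) ∧ g = ∑ i, q i * f i + r := by
  classical
  set tail : κ → MvPowerSeries (Fin n) ℂ := fun i => f i - MvPowerSeries.monomial (a i) 1
    with htail
  have htail_code : ∀ i m, MvPowerSeries.coeff m (tail i) ≠ 0 → primeCode (a i) < primeCode m := by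
    intro i m hm
    by_cases h : m = a i
    · subst h
      simp [htail, hlead] at hm
    · refine hmin i m ?_ h
      simpa [htail, MvPowerSeries.coeff_monomial, h] using hm
  have htail_conv : ∀ i, ∃ s : ℕ,
      Summable fun m => ‖MvPowerSeries.coeff m (tail i)‖ * codeWeight s m := by
    intro i
    obtain ⟨s, hs⟩ := (isConvergentSeries_iff_codeWeight _).1 (hf i)
    refine ⟨s, Summable.of_nonneg_of_le
      (fun _ => mul_nonneg (norm_nonneg _) (codeWeight_pos _ _).le) (fun m => ?_) hs⟩
    refine mul_le_mul_of_nonneg_right ?_ (codeWeight_pos _ _).le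
    by_cases h : m = a i
    · subst h
      simp [htail, hlead]
    · simp [htail, MvPowerSeries.coeff_monomial, h]
  choose s₀ hs₀ using htail_conv
  choose s₁ hs₁ htl using fun i => exists_tail_le (a i) (hs₀ i) (htail_code i)
  obtain ⟨sg, hsg⟩ := (isConvergentSeries_iff_codeWeight _).1 hg
  set s := sg + ∑ i, s₁ i with hsdef
  have hs1le : ∀ i, s₁ i ≤ s := fun i =>
    (Finset.single_le_sum (f := s₁) (fun _ _ => Nat.zero_le _) (Finset.mem_univ i)).trans
      (Nat.le_add_left _ _)
  have hsum : ∀ i, Summable fun m => ‖MvPowerSeries.coeff m (tail i)‖ * codeWeight s m :=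
    fun i => summable_codeWeight_of_le ((hs₁ i).trans (hs1le i)) (hs₀ i)
  -- Every exponent divisible by some `a i` is assigned to one such `i`; the exponents assigned
  -- `none` are those allowed in the remainder.
  obtain ⟨k, hk1, hk2⟩ : ∃ k : (Fin n →₀ ℕ) → Option κ,
      (∀ m i, k m = some i → a i ≤ m) ∧ (∀ m, k m = none → ∀ i, ¬ a i ≤ m) := by
    refine ⟨fun m => if h : ∃ i, a i ≤ m then some h.choose else none, fun m i hm => ?_,
      fun m hm => ?_⟩
    · by_cases h : ∃ i, a i ≤ m
      · simp only [h, dif_pos, Option.some.injEq] at hm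
        exact hm ▸ h.choose_spec
      · simp [h] at hm
    · by_cases h : ∃ i, a i ≤ m
      · simp [h] at hm
      · exact fun i hi => h ⟨i, hi⟩
  -- Replacing the monomial `x^m` by `x^(m - aᵢ) fᵢ` creates the error `x^(m - aᵢ) · tail i`, which
  -- involves only exponents of larger code than `m`.
  set t : (Fin n →₀ ℕ) → (Fin n →₀ ℕ) → ℂ := fun m m' => ∑ i, if k m = some i then
    MvPowerSeries.coeff m' (MvPowerSeries.monomial (m - a i) 1 * tail i) else 0 with ht
  have htsome : ∀ m i, k m = some i → ∀ m', t m m' =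
      MvPowerSeries.coeff m' (MvPowerSeries.monomial (m - a i) 1 * tail i) := by
    intro m i hm m'
    simp only [ht, hm, Option.some.injEq]
    simp
  have htnone : ∀ m, k m = none → ∀ m', t m m' = 0 := by
    intro m hm m'
    simp [ht, hm]
  have hHas : ∀ m, Summable (fun m' => ‖t m m'‖ * codeWeight s m') ∧
      ∑' m', ‖t m m'‖ * codeWeight s m' ≤ codeWeight s m / 2 := by
    intro m
    cases hm : k m with
    | none =>
      simp only [htnone m hm, norm_zero, zero_mul, tsum_zero]
      exact ⟨summable_zero, (half_pos (codeWeight_pos _ _)).le⟩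
    | some i =>
      have hinj : Function.Injective fun v : Fin n →₀ ℕ => (m - a i) + v := add_right_injective _
      have hval : ∀ v, ‖t m ((m - a i) + v)‖ * codeWeight s ((m - a i) + v) =
          codeWeight s (m - a i) * (‖MvPowerSeries.coeff v (tail i)‖ * codeWeight s v) := by
        intro v
        rw [htsome m i hm, MvPowerSeries.coeff_add_monomial_mul, one_mul, codeWeight_add]
        ring
      have hzero : ∀ m', m' ∉ Set.range (fun v : Fin n →₀ ℕ => (m - a i) + v) →
          ‖t m m'‖ * codeWeight s m' = 0 := by
        intro m' hm'
        rw [htsome m i hm, MvPowerSeries.coeff_monomial_mul, if_neg]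
        · simp
        · exact fun hle => hm' ⟨m' - (m - a i), by simp [add_tsub_cancel_of_le hle]⟩
      have hS : HasSum (fun m' => ‖t m m'‖ * codeWeight s m')
          (codeWeight s (m - a i) * ∑' v, ‖MvPowerSeries.coeff v (tail i)‖ * codeWeight s v) := by
        rw [← hinj.hasSum_iff hzero]
        have := (hsum i).hasSum.mul_left (codeWeight s (m - a i))
        exact this.congr_fun fun v => hval v
      refine ⟨hS.summable, ?_⟩
      rw [hS.tsum_eq]
      have h1 : codeWeight s m = codeWeight s (m - a i) * codeWeight s (a i) := by
        rw [← codeWeight_add, tsub_add_cancel_of_le (hk1 m i hm)]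
      rw [h1, mul_div_assoc]
      exact mul_le_mul_of_nonneg_left (htl i s (hs1le i)) (codeWeight_pos _ _).le
  obtain ⟨h, hsol, hsummable⟩ := exists_summable_solution primeCode finite_primeCode_lt t
    (codeWeight s) (codeWeight_pos s) (fun m => (hHas m).1) (fun m => (hHas m).2)
    (fun m => MvPowerSeries.coeff m g) (summable_codeWeight_of_le (Nat.le_add_right _ _) hsg)
  -- `h` gives the coefficients of `g` in the modified monomials: `x^(m - aᵢ) fᵢ` if `m` is assigned
  -- to `i`, and `x^m` otherwise. Sorting them yields quotients and remainder.
  set q : κ → MvPowerSeries (Fin n) ℂ := fun i u => if k (u + a i) = some i then h (u + a i) else 0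
    with hq
  set r : MvPowerSeries (Fin n) ℂ := fun m => if k m = none then h m else 0 with hr
  have hqc : ∀ i u, MvPowerSeries.coeff u (q i) =
      if k (u + a i) = some i then h (u + a i) else 0 := fun i u => rfl
  have hrc : ∀ m, MvPowerSeries.coeff m r = if k m = none then h m else 0 := fun m => rfl
  refine ⟨q, r, fun i => ?_, ?_, ?_, ?_⟩
  · refine (isConvergentSeries_iff_codeWeight _).2 ⟨s, ?_⟩
    have h1 : Summable fun u => ‖h (u + a i)‖ * codeWeight s (u + a i) :=
      hsummable.comp_injective (add_left_injective (a i))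
    have h2 := h1.mul_right (codeWeight s (a i))⁻¹
    refine Summable.of_nonneg_of_le
      (fun _ => mul_nonneg (norm_nonneg _) (codeWeight_pos _ _).le) (fun u => ?_) h2
    rw [codeWeight_add, mul_assoc, mul_assoc, mul_inv_cancel₀ (codeWeight_pos _ _).ne', mul_one,
      hqc]
    refine mul_le_mul_of_nonneg_right ?_ (codeWeight_pos _ _).le
    split_ifs <;> simp
  · refine (isConvergentSeries_iff_codeWeight _).2 ⟨s, ?_⟩
    refine Summable.of_nonneg_of_le
      (fun _ => mul_nonneg (norm_nonneg _) (codeWeight_pos _ _).le) (fun u => ?_) hsummable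
    refine mul_le_mul_of_nonneg_right ?_ (codeWeight_pos _ _).le
    rw [hrc]
    split_ifs <;> simp
  · intro m hm
    rw [hrc] at hm
    by_cases hkm : k m = none
    · exact hk2 m hkm
    · simp [hkm] at hm
  · ext m'
    rw [map_add, map_sum, hrc]
    have hsplit : ∀ i, MvPowerSeries.coeff m' (q i * f i) =
        (if k m' = some i then h m' else 0) + MvPowerSeries.coeff m' (q i * tail i) := by
      intro i
      have : f i = MvPowerSeries.monomial (a i) 1 + tail i := by simp [htail]
      rw [this, mul_add, map_add, MvPowerSeries.coeff_mul_monomial, mul_one]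
      congr 1
      by_cases hle : a i ≤ m'
      · rw [if_pos hle, hqc, tsub_add_cancel_of_le hle]
      · rw [if_neg hle, if_neg fun hki => hle (hk1 _ _ hki)]
    have hmain : ∀ i, MvPowerSeries.coeff m' (q i * tail i) =
        ∑ m ∈ (finite_primeCode_lt (n := n) (primeCode m')).toFinset, h m * (if k m = some i then
          MvPowerSeries.coeff m' (MvPowerSeries.monomial (m - a i) 1 * tail i) else 0) := by
      intro i
      rw [MvPowerSeries.coeff_mul]
      -- The product of the `u`-th term of `q i` with the tail comes from the modified monomial `m =
      -- u + a i`; as the tail has codes larger than that of `a i`, only `m` of smaller code than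
      -- `m'` contribute.
      refine Finset.sum_bij_ne_zero (fun p _ _ => p.1 + a i) ?_ ?_ ?_ ?_
      · intro p hp hne
        have h2 : MvPowerSeries.coeff p.2 (tail i) ≠ 0 := right_ne_zero_of_mul hne
        have h3 := htail_code i _ h2
        rw [Set.Finite.mem_toFinset, Set.mem_ofPred_eq, ← Finset.HasAntidiagonal.mem_antidiagonal.1 hp,
          primeCode_add, primeCode_add]
        exact Nat.mul_lt_mul_of_pos_left h3 (primeCode_pos _)
      · intro p hp _ p' hp' _ heq
        have h1 : p.1 = p'.1 := add_right_cancel heq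
        refine Prod.ext h1 ?_
        have := (Finset.HasAntidiagonal.mem_antidiagonal.1 hp).trans
          (Finset.HasAntidiagonal.mem_antidiagonal.1 hp').symm
        rw [h1] at this
        exact add_left_cancel this
      · intro m hm hne
        have hki : k m = some i := by
          by_contra hcon
          simp [hcon] at hne
        have hle := hk1 m i hki
        rw [if_pos hki, MvPowerSeries.coeff_monomial_mul] at hne
        have hle2 : m - a i ≤ m' := by
          by_contra hcon
          simp [hcon] at hne
        rw [if_pos hle2] at hne
        refine ⟨(m - a i, m' - (m - a i)), ?_, ?_, ?_⟩
        · exact Finset.HasAntidiagonal.mem_antidiagonal.2 (add_tsub_cancel_of_le hle2)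
        · rw [hqc]
          simp only [tsub_add_cancel_of_le hle, hki, if_true]
          simpa using hne
        · exact tsub_add_cancel_of_le hle
      · intro p hp hne
        have h1 : k (p.1 + a i) = some i := by
          by_contra hcon
          rw [hqc, if_neg hcon] at hne
          simp at hne
        rw [hqc, if_pos h1, if_pos h1, add_tsub_cancel_right,
          ← Finset.HasAntidiagonal.mem_antidiagonal.1 hp,
          MvPowerSeries.coeff_add_monomial_mul, one_mul]
    simp_rw [hsplit, hmain]
    rw [Finset.sum_add_distrib, Finset.sum_comm]
    have hs := hsol m'
    rw [hs]
    have e1 : (∑ i, if k m' = some i then h m' else 0) + (if k m' = none then h m' else 0) = h m' := by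
      cases k m' <;> simp
    have e2 : ∀ m, h m * t m m' = ∑ i, h m * (if k m = some i then
          MvPowerSeries.coeff m' (MvPowerSeries.monomial (m - a i) 1 * tail i) else 0) := by
      intro m
      rw [← Finset.mul_sum]
    simp_rw [← e2]
    linear_combination -e1

/-! ### The ring of convergent power series is Noetherian and local -/

/-- `a` is the exponent of smallest prime code of `f`, and its coefficient is one. -/
def HasLeadingExponent {n : ℕ} (f : MvPowerSeries (Fin n) ℂ) (a : Fin n →₀ ℕ) : Prop :=
  MvPowerSeries.coeff a f = 1 ∧
    ∀ m, MvPowerSeries.coeff m f ≠ 0 → m ≠ a → primeCode a < primeCode m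

theorem exists_smul_hasLeadingExponent {n : ℕ} {f : MvPowerSeries (Fin n) ℂ} (hf : f ≠ 0) :
    ∃ (c : ℂ) (a : Fin n →₀ ℕ), MvPowerSeries.coeff a f ≠ 0 ∧ HasLeadingExponent (c • f) a := by
  have hne : {m | MvPowerSeries.coeff m f ≠ 0}.Nonempty := by
    by_contra h
    refine hf (MvPowerSeries.ext fun m => ?_)
    by_contra hm
    exact h ⟨m, hm⟩
  obtain ⟨a, ha, hmin⟩ := (measure (primeCode (n := n))).wf.has_min _ hne
  refine ⟨(MvPowerSeries.coeff a f)⁻¹, a, ha, ?_, fun m hm hma => ?_⟩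
  · simpa using inv_mul_cancel₀ ha
  · have h1 : MvPowerSeries.coeff m f ≠ 0 := by
      intro h0
      simp [h0] at hm
    have h2 : ¬ primeCode m < primeCode a := hmin m h1
    exact lt_of_le_of_ne (not_lt.1 h2) fun h => hma (primeCode_injective h).symm

theorem ConvergentPowerSeries.exists_division {n : ℕ} {κ : Type*} [Fintype κ]
    (f : κ → ConvergentPowerSeries n) (a : κ → (Fin n →₀ ℕ))
    (hlead : ∀ i, HasLeadingExponent (f i : MvPowerSeries (Fin n) ℂ) (a i))
    (g : ConvergentPowerSeries n) :
    ∃ (q : κ → ConvergentPowerSeries n) (r : ConvergentPowerSeries n),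
      (∀ m, MvPowerSeries.coeff m (r : MvPowerSeries (Fin n) ℂ) ≠ 0 → ∀ i, ¬ a i ≤ m) ∧
      g = ∑ i, q i * f i + r := by
  obtain ⟨q, r, hq, hr, hr', h⟩ := exists_convergent_division
    (fun i => (f i : MvPowerSeries (Fin n) ℂ)) a (fun i => (f i).2) (fun i => (hlead i).1)
    (fun i => (hlead i).2) g g.2
  refine ⟨fun i => ⟨q i, hq i⟩, ⟨r, hr⟩, hr', Subtype.ext ?_⟩
  rw [h]
  simp

/-- Standard bases: by Dickson's lemma the leading exponents occurring in `I` have finitely many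
minimal ones. Division of an element of `I` by the corresponding series leaves a remainder in `I`;
if nonzero, its leading exponent would be divisible by a minimal one. -/
instance ConvergentPowerSeries.isNoetherianRing (n : ℕ) :
    IsNoetherianRing (ConvergentPowerSeries n) := by
  classical
  refine ⟨fun I => ?_⟩
  set E : Set (Fin n →₀ ℕ) := {a | ∃ f ∈ I, HasLeadingExponent (f : MvPowerSeries (Fin n) ℂ) a}
    with hE
  have hfin : {a | Minimal (· ∈ E) a}.Finite :=
    WellQuasiOrderedLE.finite_of_isAntichain (setOfPred_minimal_antichain _)
  have := hfin.fintype
  have hmem : ∀ a : {a | Minimal (· ∈ E) a}, ∃ f ∈ I,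
      HasLeadingExponent (f : MvPowerSeries (Fin n) ℂ) a.1 := fun a => a.2.prop
  choose f hfI hlead using hmem
  refine ⟨Finset.univ.image f, le_antisymm ?_ fun g hg => ?_⟩
  · refine Submodule.span_le.2 fun x hx => ?_
    obtain ⟨a, -, rfl⟩ := Finset.mem_image.1 (Finset.mem_coe.1 hx)
    exact hfI a
  · obtain ⟨q, r, hr, h⟩ := ConvergentPowerSeries.exists_division f (fun a => a.1) hlead g
    have hsum : ∑ i, q i * f i ∈ Ideal.span ((Finset.univ.image f : Finset _) :
        Set (ConvergentPowerSeries n)) :=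
      Ideal.sum_mem _ fun i _ => Ideal.mul_mem_left _ _ (Ideal.subset_span (by simp))
    have hrI : r ∈ I := by
      have : r = g - ∑ i, q i * f i := by rw [h]; ring
      rw [this]
      exact I.sub_mem hg (Ideal.sum_mem _ fun i _ => Ideal.mul_mem_left _ _ (hfI i))
    have hr0 : r = 0 := by
      by_contra hne
      obtain ⟨c, b, hb, hlb⟩ := exists_smul_hasLeadingExponent
        (f := (r : MvPowerSeries (Fin n) ℂ)) fun h0 => hne (Subtype.ext h0)
      have hbE : b ∈ E := by
        refine ⟨c • r, ?_, hlb⟩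
        rw [Algebra.smul_def]
        exact Ideal.mul_mem_left I _ hrI
      obtain ⟨a, hab, ha⟩ := exists_minimal_le_of_wellFoundedLT (· ∈ E) b hbE
      exact hr b hb ⟨a, ha⟩ hab
    rw [h, hr0, add_zero]
    exact hsum

/-- The constant coefficient of a convergent power series. -/
noncomputable def ConvergentPowerSeries.constCoeff (n : ℕ) : ConvergentPowerSeries n →+* ℂ :=
  (MvPowerSeries.constantCoeff (σ := Fin n) (R := ℂ)).comp (ConvergentPowerSeries n).val.toRingHom

theorem ConvergentPowerSeries.constCoeff_algebraMap (n : ℕ) (c : ℂ) :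
    ConvergentPowerSeries.constCoeff n (algebraMap ℂ _ c) = c := by
  change MvPowerSeries.constantCoeff (algebraMap ℂ (MvPowerSeries (Fin n) ℂ) c) = c
  simp [MvPowerSeries.algebraMap_apply]

/-- A series with nonzero constant term has leading exponent `0` after scaling, and `0` divides
every exponent, so dividing `1` by it leaves no remainder. -/
theorem ConvergentPowerSeries.isUnit_iff {n : ℕ} (f : ConvergentPowerSeries n) :
    IsUnit f ↔ ConvergentPowerSeries.constCoeff n f ≠ 0 := by
  refine ⟨fun h => (h.map _).ne_zero, fun h => ?_⟩
  set c := ConvergentPowerSeries.constCoeff n f with hc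
  have hlead : ∀ _ : Unit, HasLeadingExponent
      ((c⁻¹ • f : ConvergentPowerSeries n) : MvPowerSeries (Fin n) ℂ) 0 := by
    intro _
    refine ⟨?_, fun m _ hm0 => ?_⟩
    · change MvPowerSeries.coeff 0 (c⁻¹ • (f : MvPowerSeries (Fin n) ℂ)) = 1
      rw [MvPowerSeries.coeff_smul]
      exact inv_mul_cancel₀ h
    · exact lt_of_le_of_ne (by rw [primeCode_zero]; exact primeCode_pos m)
        fun heq => hm0 (primeCode_injective heq).symm
  obtain ⟨q, r, hr, h1⟩ := ConvergentPowerSeries.exists_division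
    (fun _ : Unit => c⁻¹ • f) (fun _ => 0) hlead 1
  have hr0 : r = 0 := by
    refine Subtype.ext (MvPowerSeries.ext fun m => ?_)
    by_contra hm
    exact hr m hm () zero_le
  rw [hr0] at h1
  refine IsUnit.of_mul_eq_one (c⁻¹ • q ()) ?_
  rw [h1]
  simp [mul_comm]

instance ConvergentPowerSeries.isLocalRing (n : ℕ) : IsLocalRing (ConvergentPowerSeries n) := by
  have : IsLocalHom (ConvergentPowerSeries.constCoeff n) :=
    ⟨fun f hf => (ConvergentPowerSeries.isUnit_iff f).2 hf.ne_zero⟩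
  exact RingHom.domain_isLocalRing (ConvergentPowerSeries.constCoeff n)

theorem LocalAnalyticRing.isNoetherianRing (n : ℕ) (I : Ideal (ConvergentPowerSeries n)) :
    IsNoetherianRing (LocalAnalyticRing n I) :=
  inferInstanceAs (IsNoetherianRing (ConvergentPowerSeries n ⧸ I))

theorem LocalAnalyticRing.isReduced {n : ℕ} {I : Ideal (ConvergentPowerSeries n)}
    (hI : I.IsRadical) : IsReduced (LocalAnalyticRing n I) :=
  (Ideal.isRadical_iff_quotient_reduced I).1 hI

theorem LocalAnalyticRing.isLocalRing {n : ℕ} (I : Ideal (ConvergentPowerSeries n))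
    [Nontrivial (LocalAnalyticRing n I)] : IsLocalRing (LocalAnalyticRing n I) :=
  IsLocalRing.of_surjective' (Ideal.Quotient.mk I) Ideal.Quotient.mk_surjective

theorem LocalAnalyticRing.exists_sub_mem {n : ℕ} {I : Ideal (ConvergentPowerSeries n)}
    [IsLocalRing (LocalAnalyticRing n I)] (x : LocalAnalyticRing n I) :
    ∃ c : ℂ, x - algebraMap ℂ _ c ∈ IsLocalRing.maximalIdeal (LocalAnalyticRing n I) := by
  obtain ⟨f, rfl⟩ := Ideal.Quotient.mk_surjective (I := I) x
  refine ⟨ConvergentPowerSeries.constCoeff n f, ?_⟩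
  rw [IsLocalRing.mem_maximalIdeal, mem_nonunits_iff]
  intro hu
  have : Nontrivial (ConvergentPowerSeries n ⧸ I) :=
    inferInstanceAs (Nontrivial (LocalAnalyticRing n I))
  have : IsLocalHom (Ideal.Quotient.mk I) :=
    IsLocalHom.of_surjective _ Ideal.Quotient.mk_surjective
  have h2 : IsUnit (Ideal.Quotient.mk I
      (f - algebraMap ℂ _ (ConvergentPowerSeries.constCoeff n f))) := hu
  have h3 := (ConvergentPowerSeries.isUnit_iff _).1 (isUnit_of_map_unit _ _ h2)
  rw [map_sub, ConvergentPowerSeries.constCoeff_algebraMap, sub_self] at h3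
  exact h3 rfl

/-! ### Reduced one-dimensional local rings with residue field `ℂ` -/

/-- The algebraic properties of the local ring of a reduced complex curve germ: a reduced
one-dimensional Noetherian local ring with residue field `ℂ`. -/
class IsCurveRing (R : Type*) [CommRing R] [Algebra ℂ R] : Prop extends
    IsNoetherianRing R, IsLocalRing R, IsReduced R where
  ringKrullDim_eq_one : ringKrullDim R = 1
  exists_sub_mem (x : R) : ∃ c : ℂ, x - algebraMap ℂ R c ∈ IsLocalRing.maximalIdeal R

section CurveRing

variable {R : Type*} [CommRing R] [Algebra ℂ R] [IsCurveRing R]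

open nonZeroDivisors

/-- As the residue field is `ℂ`, generators of the `k`-th power of the maximal ideal span it over
`ℂ` modulo the next power. -/
theorem finite_quotient_of_pow_maximalIdeal_le {J : Ideal R} {N : ℕ}
    (hJ : IsLocalRing.maximalIdeal R ^ N ≤ J) : Module.Finite ℂ (R ⧸ J) := by
  have key : ∀ k, ∃ T : Finset R,
      (⊤ : Submodule ℂ R) ≤
        Submodule.span ℂ (T : Set R) ⊔ (IsLocalRing.maximalIdeal R ^ k).restrictScalars ℂ := by
    intro k
    induction k with
    | zero => exact ⟨∅, fun x _ => Submodule.mem_sup_right (by simp)⟩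
    | succ k ih =>
      classical
      obtain ⟨T, hT⟩ := ih
      obtain ⟨U, hU⟩ := IsNoetherian.noetherian (IsLocalRing.maximalIdeal R ^ k)
      refine ⟨T ∪ U, hT.trans ?_⟩
      rw [Finset.coe_union, Submodule.span_union, sup_assoc]
      refine sup_le_sup_left (fun x hx => ?_) _
      have hx' : x ∈ Submodule.span R (U : Set R) := by rw [hU]; exact hx
      refine Submodule.span_induction (fun y hy => ?_) (Submodule.zero_mem _)
        (fun y z _ _ hy hz => Submodule.add_mem _ hy hz) (fun r y hy hy' => ?_) hx'
      · exact Submodule.mem_sup_left (Submodule.subset_span hy)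
      · obtain ⟨c, hc⟩ := IsCurveRing.exists_sub_mem r
        have : r • y = c • y + (r - algebraMap ℂ R c) * y := by
          rw [Algebra.smul_def c y, smul_eq_mul]; ring
        rw [this]
        refine Submodule.add_mem _ (Submodule.smul_mem _ _ hy') (Submodule.mem_sup_right ?_)
        have hyU : y ∈ IsLocalRing.maximalIdeal R ^ k := by rw [← hU]; exact hy
        rw [pow_succ']
        exact Ideal.mul_mem_mul hc hyU
  classical
  obtain ⟨T, hT⟩ := key N
  refine ⟨⟨T.image (Ideal.Quotient.mk J), ?_⟩⟩
  rw [eq_top_iff]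
  intro x _
  obtain ⟨y, rfl⟩ := Ideal.Quotient.mk_surjective x
  obtain ⟨u, hu, v, hv, rfl⟩ := Submodule.mem_sup.1 (hT (Submodule.mem_top (x := y)))
  have hv0 : Ideal.Quotient.mk J v = 0 := Ideal.Quotient.eq_zero_iff_mem.2 (hJ hv)
  rw [map_add, hv0, add_zero, Finset.coe_image]
  have := Submodule.mem_map_of_mem (f := (Ideal.Quotient.mkₐ ℂ J).toLinearMap) hu
  rw [Submodule.map_span] at this
  exact this

/-- Dividing by a nonzerodivisor lowers the dimension to zero, so the quotient is Artinian and its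
maximal ideal nilpotent. -/
theorem exists_pow_maximalIdeal_le_span {c : R} (hc : c ∈ R⁰) :
    ∃ N, IsLocalRing.maximalIdeal R ^ N ≤ Ideal.span {c} := by
  by_cases h : Ideal.span {c} = ⊤
  · exact ⟨0, by rw [h]; exact le_top⟩
  have : Nontrivial (R ⧸ Ideal.span {c}) := Ideal.Quotient.nontrivial_iff.2 h
  have : IsLocalRing (R ⧸ Ideal.span {c}) :=
    IsLocalRing.of_surjective' _ Ideal.Quotient.mk_surjective
  have hdim := ringKrullDim_quotient_succ_le_of_nonZeroDivisor hc
  rw [IsCurveRing.ringKrullDim_eq_one (R := R)] at hdim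
  have hdim0 : Ring.KrullDimLE 0 (R ⧸ Ideal.span {c}) := by
    rw [Ring.krullDimLE_iff]
    generalize ringKrullDim (R ⧸ Ideal.span {c}) = x at hdim
    cases x with
    | bot => exact bot_le
    | coe y =>
      have h1 : y + 1 ≤ 0 + 1 := by exact_mod_cast hdim
      exact_mod_cast (ENat.add_le_add_iff_right (by decide)).1 h1
  obtain ⟨N, hN⟩ := (isArtinianRing_iff_isNilpotent_maximalIdeal _).1
    (isArtinianRing_iff_krullDimLE_zero.2 hdim0)
  refine ⟨N, ?_⟩
  have hmap : (IsLocalRing.maximalIdeal R).map (Ideal.Quotient.mk (Ideal.span {c})) ≤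
      IsLocalRing.maximalIdeal _ := by
    have : IsLocalHom (Ideal.Quotient.mk (Ideal.span {c})) :=
      IsLocalHom.of_surjective _ Ideal.Quotient.mk_surjective
    exact ((IsLocalRing.local_hom_TFAE _).out 0 2).1 this
  have h0 : ((IsLocalRing.maximalIdeal R) ^ N).map (Ideal.Quotient.mk (Ideal.span {c})) ≤ ⊥ := by
    rw [Ideal.map_pow]
    exact (Ideal.pow_right_mono hmap N).trans hN.le
  intro x hx
  exact Ideal.Quotient.eq_zero_iff_mem.1 (by simpa using h0 (Ideal.mem_map_of_mem _ hx))

theorem mem_nonZeroDivisors_iff_forall_minimalPrimes {S : Type*} [CommRing S] [IsReduced S]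
    {x : S} : x ∈ S⁰ ↔ ∀ P ∈ minimalPrimes S, x ∉ P := by
  refine ⟨fun hx P hP hxP => notMem_nonZeroDivisors_of_mem_mem_minimalPrimes hxP hP hx,
    fun h => mem_nonZeroDivisors_iff_right.2 fun y hy => ?_⟩
  have h1 : y ∈ sInf (minimalPrimes S) := by
    refine Ideal.mem_sInf.2 fun {P} hP => ?_
    have : P.IsPrime := hP.1.1
    exact (this.mem_or_mem (hy ▸ P.zero_mem : y * x ∈ P)).resolve_right (h P hP)
  rw [minimalPrimes, Ideal.sInf_minimalPrimes] at h1
  have h2 : IsNilpotent y := mem_nilradical.1 h1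
  exact h2.eq_zero

/-- A vector generating an ideal outside all minimal primes has linear combinations with
coefficients `1, s, s², …`, `s ∈ ℂ`, which are nonzerodivisors. -/
theorem exists_sum_pow_mul_mem_nonZeroDivisors {n : ℕ} (a : Fin n → R)
    (ha : ∀ P ∈ minimalPrimes R, ∃ i, a i ∉ P) :
    ∃ s : ℂ, ∑ i : Fin n, algebraMap ℂ R s ^ (i : ℕ) * a i ∈ R⁰ := by
  classical
  -- Modulo each of the finitely many minimal primes the sum is a nonzero polynomial in `s` over a
  -- domain, so it vanishes for finitely many `s` only.
  have hfin : (⋃ P ∈ minimalPrimes R,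
      {s : ℂ | ∑ i : Fin n, algebraMap ℂ R s ^ (i : ℕ) * a i ∈ P}).Finite := by
    refine (minimalPrimes.finite_of_isNoetherianRing R).biUnion fun P hP => ?_
    have : P.IsPrime := hP.1.1
    let f : Polynomial (R ⧸ P) := ∑ i : Fin n, Polynomial.monomial (i : ℕ) (Ideal.Quotient.mk P (a i))
    have hf : f ≠ 0 := by
      obtain ⟨j, hj⟩ := ha P hP
      intro h0
      have h1 : f.coeff j = 0 := by rw [h0, Polynomial.coeff_zero]
      simp only [f, Polynomial.finsetSum_coeff, Polynomial.coeff_monomial] at h1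
      rw [Finset.sum_eq_single j] at h1
      · simp only [if_true] at h1
        exact hj (Ideal.Quotient.eq_zero_iff_mem.1 h1)
      · intro i _ hij
        rw [if_neg fun h => hij (Fin.ext h)]
      · simp
    refine (Set.Finite.preimage (f := algebraMap ℂ (R ⧸ P))
      (algebraMap ℂ (R ⧸ P)).injective.injOn (f.roots.toFinset.finite_toSet)).subset fun s hs => ?_
    simp only [Set.mem_preimage, Finset.mem_coe, Multiset.mem_toFinset, Polynomial.mem_roots hf,
      Polynomial.IsRoot.def]
    have := Ideal.Quotient.eq_zero_iff_mem.2 hs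
    simp only [f, Polynomial.eval_finsetSum, Polynomial.eval_monomial]
    rw [← this, map_sum]
    refine Finset.sum_congr rfl fun i _ => ?_
    rw [map_mul, map_pow, mul_comm]
    rfl
  obtain ⟨s, hs⟩ := hfin.exists_notMem
  refine ⟨s, mem_nonZeroDivisors_iff_forall_minimalPrimes.2 fun P hP h => hs ?_⟩
  simp only [Set.mem_iUnion]
  exact ⟨P, hP, h⟩

/-- A maximal ideal contained in a minimal prime would be the only prime, contrary to dimension one;
so its generators have a combination avoiding all minimal primes. -/
theorem exists_mem_maximalIdeal_nonZeroDivisors :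
    ∃ t ∈ IsLocalRing.maximalIdeal R, t ∈ R⁰ := by
  obtain ⟨U, hU⟩ := IsNoetherian.noetherian (IsLocalRing.maximalIdeal R)
  have hmin : ∀ P ∈ minimalPrimes R, ∃ i : Fin U.card, ((U.equivFin.symm i : U) : R) ∉ P := by
    intro P hP
    by_contra! hcon
    have hle : IsLocalRing.maximalIdeal R ≤ P := by
      rw [← hU]
      refine Submodule.span_le.2 fun x hx => ?_
      simpa using hcon (U.equivFin ⟨x, hx⟩)
    have hPm : P = IsLocalRing.maximalIdeal R :=
      le_antisymm (IsLocalRing.le_maximalIdeal hP.1.1.ne_top) hle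
    have h0 : Ring.KrullDimLE 0 R := by
      refine Ring.krullDimLE_zero_iff.2 fun Q hQ => ?_
      have hQm : Q = IsLocalRing.maximalIdeal R :=
        le_antisymm (IsLocalRing.le_maximalIdeal hQ.ne_top)
          (hPm ▸ hP.2 ⟨hQ, bot_le⟩ (hPm ▸ IsLocalRing.le_maximalIdeal hQ.ne_top))
      exact hQm ▸ inferInstance
    have := Ring.krullDimLE_iff.1 h0
    rw [IsCurveRing.ringKrullDim_eq_one (R := R)] at this
    exact absurd this (by decide)
  obtain ⟨s, hs⟩ := exists_sum_pow_mul_mem_nonZeroDivisors _ hmin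
  refine ⟨_, Ideal.sum_mem _ fun i _ => Ideal.mul_mem_left _ _ ?_, hs⟩
  rw [← hU]
  exact Ideal.subset_span (U.equivFin.symm i).2

end CurveRing

/-! ### Lengths of cokernels -/

section CokerLength

open nonZeroDivisors

variable {R : Type*} [CommRing R] [Algebra ℂ R]
variable {X Y Z : Type*} [AddCommGroup X] [Module R X] [Module ℂ X] [IsScalarTower ℂ R X]
  [AddCommGroup Y] [Module R Y] [Module ℂ Y] [IsScalarTower ℂ R Y]
  [AddCommGroup Z] [Module R Z] [Module ℂ Z] [IsScalarTower ℂ R Z]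

theorem length_quotient_map (f : X →ₗ[R] Y) (hf : Function.Injective f) (N : Submodule R X) :
    Module.length ℂ (Y ⧸ N.map f) =
      Module.length ℂ (X ⧸ N) + Module.length ℂ (Y ⧸ LinearMap.range f) := by
  let i : (X ⧸ N) →ₗ[R] (Y ⧸ N.map f) := N.mapQ (N.map f) f (Submodule.le_comap_map f N)
  let p : (Y ⧸ N.map f) →ₗ[R] (Y ⧸ LinearMap.range f) := Submodule.factor LinearMap.map_le_range
  have hi : Function.Injective i := by
    rw [injective_iff_map_eq_zero]
    intro x hx
    obtain ⟨x, rfl⟩ := N.mkQ_surjective x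
    obtain ⟨y, hy, hyx⟩ := (Submodule.Quotient.mk_eq_zero (N.map f)).1 hx
    rw [hf hyx] at hy
    exact (Submodule.Quotient.mk_eq_zero N).2 hy
  have hip : Function.Exact i p := by
    intro y
    obtain ⟨y, rfl⟩ := (N.map f).mkQ_surjective y
    constructor
    · intro h
      obtain ⟨x, rfl⟩ := (Submodule.Quotient.mk_eq_zero (LinearMap.range f)).1 h
      exact ⟨N.mkQ x, rfl⟩
    · rintro ⟨x, hx⟩
      obtain ⟨x, rfl⟩ := N.mkQ_surjective x
      rw [← hx]
      exact (Submodule.Quotient.mk_eq_zero (LinearMap.range f)).2 ⟨x, rfl⟩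
  have hp : Function.Surjective p := Submodule.factor_surjective _
  clear_value i p
  exact Module.length_eq_add_of_exact (i.restrictScalars ℂ) (p.restrictScalars ℂ) hi hp hip

/-- The `ℂ`-length of the cokernel. -/
noncomputable def cokerLength (f : X →ₗ[R] Y) : ℕ∞ := Module.length ℂ (Y ⧸ LinearMap.range f)

omit [Module ℂ X] [IsScalarTower ℂ R X] in
-- The cokernel of a composite is an extension of the two cokernels when the outer map is injective.
-- With values in `ℕ∞` this needs no finiteness.
theorem cokerLength_comp (f : Y →ₗ[R] Z) (g : X →ₗ[R] Y) (hf : Function.Injective f) :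
    cokerLength (f ∘ₗ g) = cokerLength f + cokerLength g := by
  unfold cokerLength
  rw [LinearMap.range_comp, length_quotient_map f hf, add_comm]

omit [Module ℂ X] [IsScalarTower ℂ R X] in
theorem cokerLength_eq_zero {f : X →ₗ[R] Y} (hf : Function.Surjective f) : cokerLength f = 0 := by
  unfold cokerLength
  rw [LinearMap.range_eq_top.2 hf]
  exact Module.length_eq_zero

theorem length_quotient_eq_add {A B : Submodule R X} (h : A ≤ B) :
    Module.length ℂ (X ⧸ A) = Module.length ℂ (B ⧸ A.submoduleOf B) + Module.length ℂ (X ⧸ B) := by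
  have h1 := length_quotient_map B.subtype B.injective_subtype (A.submoduleOf B)
  have h2 : (A.submoduleOf B).map B.subtype = A := by
    rw [Submodule.submoduleOf, Submodule.map_comap_subtype, inf_eq_right.2 h]
  rwa [h2, Submodule.range_subtype] at h1

/-- If `c B ⊆ A = im f ⊆ B`, then `B / A` is at most as long as `H / c H`, `H` the source of `f`. -/
theorem length_subquotient_le {c : R} (hc : Function.Injective (LinearMap.lsmul R Y c))
    (f : X →ₗ[R] Y) {A B : Submodule R Y} (hA : A = LinearMap.range f)
    (hB : ∀ b ∈ B, c • b ∈ A) :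
    Module.length ℂ (B ⧸ A.submoduleOf B) ≤ cokerLength (LinearMap.lsmul R X c) := by
  let cA : Submodule R A := LinearMap.range (LinearMap.lsmul R A c)
  let m : B →ₗ[R] A := ((LinearMap.lsmul R Y c).comp B.subtype).codRestrict A fun b => hB b b.2
  have hm : A.submoduleOf B ≤ cA.comap m := by
    intro b hb
    exact ⟨⟨b, hb⟩, rfl⟩
  -- Multiplication by `c` embeds `B / A` into `A / cA`, and `f` presents `A / cA` as a quotient of
  -- `X / cX`.
  let i := (A.submoduleOf B).mapQ cA m hm
  have hi : Function.Injective i := by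
    rw [injective_iff_map_eq_zero]
    intro x hx
    obtain ⟨x, rfl⟩ := (A.submoduleOf B).mkQ_surjective x
    have : m x ∈ cA := by simpa [i] using hx
    obtain ⟨a, ha⟩ := this
    have h1 : (a : Y) = x := hc (congrArg Subtype.val ha)
    have : x ∈ A.submoduleOf B := by
      change (x : Y) ∈ A
      rw [← h1]
      exact a.2
    simpa using this
  have hmem : ∀ x, f x ∈ A := fun x => hA ▸ LinearMap.mem_range_self f x
  let g : X →ₗ[R] A := f.codRestrict A hmem
  have hg : LinearMap.range (LinearMap.lsmul R X c) ≤ cA.comap g := by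
    rintro _ ⟨x, rfl⟩
    exact ⟨g x, by simp⟩
  let j := (LinearMap.range (LinearMap.lsmul R X c)).mapQ cA g hg
  have hj : Function.Surjective j := by
    intro y
    obtain ⟨⟨y, hy⟩, rfl⟩ := cA.mkQ_surjective y
    have hy' := hy
    rw [hA] at hy'
    obtain ⟨x, rfl⟩ := hy'
    exact ⟨(LinearMap.range (LinearMap.lsmul R X c)).mkQ x, rfl⟩
  exact (Module.length_le_of_injective (i.restrictScalars ℂ) hi).trans
    (Module.length_le_of_surjective (j.restrictScalars ℂ) hj)

theorem cokerLength_lsmul_pi {κ : Type*} [Fintype κ] (c : R) :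
    cokerLength (LinearMap.lsmul R (κ → R) c) =
      Fintype.card κ * cokerLength (LinearMap.lsmul R R c) := by
  let I := LinearMap.range (LinearMap.lsmul R R c)
  let φ : (κ → R) →ₗ[R] (κ → R ⧸ I) := LinearMap.pi fun i => I.mkQ ∘ₗ LinearMap.proj i
  have hφ : Function.Surjective φ := by
    intro y
    choose x hx using fun i => I.mkQ_surjective (y i)
    exact ⟨x, funext hx⟩
  have hker : LinearMap.ker φ = LinearMap.range (LinearMap.lsmul R (κ → R) c) := by
    ext x
    constructor
    · intro h
      have : ∀ i, x i ∈ I := fun i => by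
        have := congrFun (LinearMap.mem_ker.1 h) i
        exact (Submodule.Quotient.mk_eq_zero I).1 this
      choose y hy using this
      exact ⟨y, funext hy⟩
    · rintro ⟨y, rfl⟩
      refine LinearMap.mem_ker.2 (funext fun i => ?_)
      exact (Submodule.Quotient.mk_eq_zero I).2 ⟨y i, rfl⟩
  unfold cokerLength
  have e : ((κ → R) ⧸ LinearMap.range (LinearMap.lsmul R (κ → R) c)) ≃ₗ[R] (κ → R ⧸ I) :=
    (Submodule.quotEquivOfEq _ _ hker.symm).trans (φ.quotKerEquivOfSurjective hφ)
  rw [(e.restrictScalars ℂ).length_eq, Module.length_pi, ENat.card_eq_coe_fintype_card]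

omit [Algebra ℂ R] in
theorem range_lsmul_self (c : R) : LinearMap.range (LinearMap.lsmul R R c) = Ideal.span {c} := by
  ext x
  simp [Ideal.mem_span_singleton', mul_comm]

omit [Algebra ℂ R] in
theorem lsmul_injective {c : R} (hc : c ∈ R⁰) : Function.Injective (LinearMap.lsmul R R c) := by
  rw [injective_iff_map_eq_zero]
  intro x hx
  exact (mem_nonZeroDivisors_iff_left.1 hc) x hx

theorem cokerLength_lsmul_ne_top [IsCurveRing R] {c : R} (hc : c ∈ R⁰) :
    cokerLength (LinearMap.lsmul R R c) ≠ ⊤ := by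
  obtain ⟨N, hN⟩ := exists_pow_maximalIdeal_le_span hc
  have := finite_quotient_of_pow_maximalIdeal_le hN
  unfold cokerLength
  rw [range_lsmul_self, Module.length_eq_finrank]
  exact ENat.natCast_ne_top _

theorem cokerLength_lsmul_mul {c d : R} (hc : c ∈ R⁰) :
    cokerLength (LinearMap.lsmul R R (c * d)) =
      cokerLength (LinearMap.lsmul R R c) + cokerLength (LinearMap.lsmul R R d) := by
  have : LinearMap.lsmul R R (c * d) = LinearMap.lsmul R R c ∘ₗ LinearMap.lsmul R R d := by
    ext
    simp
  rw [this]
  exact cokerLength_comp _ _ (lsmul_injective hc)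

theorem cokerLength_lsmul_pow {c : R} (hc : c ∈ R⁰) (l : ℕ) :
    cokerLength (LinearMap.lsmul R R (c ^ l)) = l * cokerLength (LinearMap.lsmul R R c) := by
  induction l with
  | zero =>
    rw [cokerLength_eq_zero fun x => ⟨x, by simp⟩]
    simp
  | succ l ih =>
    rw [pow_succ, cokerLength_lsmul_mul (pow_mem hc l), ih]
    push_cast
    ring

end CokerLength

/-! ### Additive functions of matrices depend only on the determinant -/

section MatrixDet

open nonZeroDivisors

variable {R : Type*} [CommRing R] [Algebra ℂ R] [IsCurveRing R]

/-- After a unimodular column operation, a matrix with nonzerodivisor determinant has a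
nonzerodivisor in the last diagonal entry. -/
theorem exists_mul_last_last_mem_nonZeroDivisors {n : ℕ} (A : Matrix (Fin (n + 1)) (Fin (n + 1)) R)
    (hA : A.det ∈ R⁰) : ∃ U : Matrix (Fin (n + 1)) (Fin (n + 1)) R, U.det = 1 ∧
      (A * U) (Fin.last n) (Fin.last n) ∈ R⁰ := by
  obtain ⟨s, hs⟩ := exists_sum_pow_mul_mem_nonZeroDivisors
    (fun i : Fin (n + 1) => A (Fin.last n) i.rev) (by
      intro P hP
      by_contra! hcon
      have : P.IsPrime := hP.1.1
      refine mem_nonZeroDivisors_iff_forall_minimalPrimes.1 hA P hP ?_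
      rw [← Ideal.Quotient.eq_zero_iff_mem, RingHom.map_det]
      refine Matrix.det_eq_zero_of_row_eq_zero (Fin.last n) fun j => ?_
      have := hcon j.rev
      rw [Fin.rev_rev] at this
      exact Ideal.Quotient.eq_zero_iff_mem.2 this)
  -- The powers are taken in reverse order so that the last one is `s ^ 0 = 1`, which makes the
  -- column operation unimodular.
  let w : Fin (n + 1) → R := fun j => algebraMap ℂ R s ^ (j.rev : ℕ)
  refine ⟨(1 : Matrix _ _ R).updateCol (Fin.last n) w, ?_, ?_⟩
  · rw [← Matrix.cramer_apply, Matrix.cramer_one]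
    simp [w]
  · have : (A * (1 : Matrix _ _ R).updateCol (Fin.last n) w) (Fin.last n) (Fin.last n) =
        ∑ i : Fin (n + 1), algebraMap ℂ R s ^ (i : ℕ) * A (Fin.last n) i.rev := by
      rw [Matrix.mul_apply, ← Equiv.sum_comp Fin.revPerm]
      refine Finset.sum_congr rfl fun i _ => ?_
      have h1 : n - (n - (i : ℕ)) = i := by omega
      simp [w, mul_comm, h1]
    rwa [this]

/-- A function on the matrices with nonzerodivisor determinant which turns products into sums and
is given by `ω` on elementary diagonal matrices is `ω ∘ det`. -/
theorem eq_comp_det_of_diagonal {ω : R → ℕ∞} (hω1 : ω 1 = 0)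
    (hωmul : ∀ a ∈ R⁰, ∀ b ∈ R⁰, ω (a * b) = ω a + ω b) (hωfin : ∀ a ∈ R⁰, ω a ≠ ⊤) (n : ℕ) :
    ∀ μ : Matrix (Fin n) (Fin n) R → ℕ∞,
      (∀ A B, A.det ∈ R⁰ → B.det ∈ R⁰ → μ (A * B) = μ A + μ B) →
      (∀ A, IsUnit A.det → μ A = 0) →
      (∀ i, ∀ a ∈ R⁰, μ (Matrix.diagonal (Function.update 1 i a)) = ω a) →
      ∀ A, A.det ∈ R⁰ → μ A = ω A.det := by
  induction n with
  | zero =>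
    intro μ _ hunit _ A _
    rw [hunit A (by simp), Matrix.det_fin_zero, hω1]
  | succ n ih =>
    intro μ hmul hunit hdiag A₀ hA₀
    obtain ⟨U, hU, hpiv⟩ := exists_mul_last_last_mem_nonZeroDivisors A₀ hA₀
    have hU0 : U.det ∈ R⁰ := hU ▸ one_mem _
    have hA1 : μ A₀ = μ (A₀ * U) := by
      rw [hmul _ _ hA₀ hU0, hunit U (hU ▸ isUnit_one), add_zero]
    have hA2 : A₀.det = (A₀ * U).det := by rw [Matrix.det_mul, hU, mul_one]
    rw [hA1, hA2]
    rw [hA2] at hA₀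
    generalize A₀ * U = A at hA₀ hpiv
    clear hA1 hA2 hU0
    set a := A (Fin.last n) (Fin.last n) with ha
    let e : Fin n ⊕ Fin 1 ≃ Fin (n + 1) := finSumFinEquiv
    let ν : Matrix (Fin n ⊕ Fin 1) (Fin n ⊕ Fin 1) R → ℕ∞ := fun X => μ (X.submatrix e.symm e.symm)
    have νmul : ∀ X Y, X.det ∈ R⁰ → Y.det ∈ R⁰ → ν (X * Y) = ν X + ν Y := by
      intro X Y hX hY
      simp only [ν]
      rw [← Matrix.submatrix_mul_equiv X Y e.symm e.symm e.symm]
      exact hmul _ _ (by rwa [Matrix.det_submatrix_equiv_self])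
        (by rwa [Matrix.det_submatrix_equiv_self])
    have νunit : ∀ X, IsUnit X.det → ν X = 0 := fun X hX =>
      hunit _ (by rwa [Matrix.det_submatrix_equiv_self])
    have νdiag : ∀ i, ∀ b ∈ R⁰, ν (Matrix.diagonal (Function.update 1 i b)) = ω b := by
      intro i b hb
      simp only [ν]
      rw [Matrix.submatrix_diagonal_equiv, ← hdiag (e i) b hb]
      congr 2
      ext j
      simp only [Function.comp_apply, Function.update_apply, Equiv.symm_apply_eq]
      rfl
    have hblock : ∀ Y : Matrix (Fin n) (Fin n) R, Y.det ∈ R⁰ →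
        ν (Matrix.fromBlocks Y 0 0 1) = ω Y.det := by
      refine ih (fun Y => ν (Matrix.fromBlocks Y 0 0 1)) ?_ ?_ ?_
      · intro X Y hX hY
        rw [← νmul _ _ (by simpa using hX) (by simpa using hY), Matrix.fromBlocks_multiply]
        simp
      · intro Y hY
        exact νunit _ (by simpa using hY)
      · intro i b hb
        rw [← νdiag (Sum.inl i) b hb, ← Matrix.diagonal_one, Matrix.fromBlocks_diagonal]
        congr 2
        ext j
        rcases j with j | j
        · simp [Function.update_apply]
        · simp
    obtain ⟨B, hB⟩ : ∃ B, A = B.submatrix e.symm e.symm := ⟨A.submatrix e e, by simp⟩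
    have hdetB : A.det = B.det := by rw [hB, Matrix.det_submatrix_equiv_self]
    have hμB : μ A = ν B := by rw [hB]
    have haB : B.toBlocks₂₂ = a • (1 : Matrix (Fin 1) (Fin 1) R) := by
      ext i j
      rw [Subsingleton.elim i 0, Subsingleton.elim j 0]
      have h1 : e (Sum.inr 0) = Fin.last n := by
        ext
        simp [e]
      rw [ha, hB, ← h1]
      simp [Matrix.toBlocks₂₂]
    rw [hμB, hdetB]
    rw [hdetB] at hA₀
    set P := B.toBlocks₁₁
    set v := B.toBlocks₁₂
    set r := B.toBlocks₂₁
    have hBb : B = Matrix.fromBlocks P v r (a • 1) := by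
      rw [← haB]
      exact (Matrix.fromBlocks_toBlocks B).symm
    set Q := a • P - v * r with hQ
    set L₁ : Matrix (Fin n ⊕ Fin 1) (Fin n ⊕ Fin 1) R := Matrix.fromBlocks 1 (-v) 0 1
    set L₂ : Matrix (Fin n ⊕ Fin 1) (Fin n ⊕ Fin 1) R :=
      Matrix.fromBlocks (a • (1 : Matrix (Fin n) (Fin n) R)) 0 0 1 with hL₂
    set M₁ : Matrix (Fin n ⊕ Fin 1) (Fin n ⊕ Fin 1) R := Matrix.fromBlocks Q 0 0 1
    set M₂ : Matrix (Fin n ⊕ Fin 1) (Fin n ⊕ Fin 1) R := Matrix.fromBlocks 1 0 r 1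
    set M₃ : Matrix (Fin n ⊕ Fin 1) (Fin n ⊕ Fin 1) R :=
      Matrix.fromBlocks 1 0 0 (a • (1 : Matrix (Fin 1) (Fin 1) R)) with hM₃
    -- Elimination with pivot `a`, denominators cleared; `Q` is the scaled Schur complement. Besides
    -- `B`, each factor is unimodular, or a block `diag(Y, 1)` covered by induction, or the
    -- elementary diagonal matrix `M₃`.
    have hfact : L₁ * L₂ * B = M₁ * (M₂ * M₃) := by
      rw [hBb]
      simp [L₁, L₂, M₁, M₂, M₃, Matrix.fromBlocks_multiply, hQ, sub_eq_add_neg]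
    have hL₁ : L₁.det = 1 := by simp [L₁]
    have hL₂d : L₂.det = a ^ n := by simp [L₂]
    have hM₁d : M₁.det = Q.det := by simp [M₁]
    have hM₂ : M₂.det = 1 := by simp [M₂]
    have hM₃d : M₃.det = a := by simp [M₃]
    have hdet : a ^ n * B.det = Q.det * a := by
      have := congrArg Matrix.det hfact
      simpa only [Matrix.det_mul, hL₁, hL₂d, hM₁d, hM₂, hM₃d, one_mul] using this
    have han : a ^ n ∈ R⁰ := pow_mem hpiv n
    have hQd : Q.det ∈ R⁰ := by
      have h1 : Q.det * a ∈ R⁰ := hdet ▸ mul_mem han hA₀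
      exact (mul_mem_nonZeroDivisors.1 h1).1
    have hν := congrArg ν hfact
    have νM₃ : ν M₃ = ω a := by
      rw [← νdiag (Sum.inr 0) a hpiv, hM₃, ← Matrix.diagonal_one, ← Matrix.diagonal_one,
        ← Matrix.diagonal_smul, Matrix.fromBlocks_diagonal]
      congr 2
      ext j
      rcases j with j | j
      · simp
      · simp [Subsingleton.elim j 0]
    rw [νmul _ _ (by rw [Matrix.det_mul, hL₁, hL₂d, one_mul]; exact han) hA₀,
      νmul _ _ (hL₁ ▸ one_mem _) (hL₂d ▸ han), νunit L₁ (hL₁ ▸ isUnit_one),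
      hblock _ (by simpa using han),
      νmul _ _ (hM₁d ▸ hQd) (by rw [Matrix.det_mul, hM₂, hM₃d, one_mul]; exact hpiv),
      νmul _ _ (hM₂ ▸ one_mem _) (hM₃d ▸ hpiv), νunit M₂ (hM₂ ▸ isUnit_one),
      hblock _ hQd, νM₃, zero_add, zero_add, ← hωmul _ hQd _ hpiv, ← hdet, hωmul _ han _ hA₀,
      Matrix.det_smul, Matrix.det_one, mul_one, Fintype.card_fin] at hν
    -- Scaling the first `n` rows added `ω (a ^ n)` to both sides; being finite, it cancels.
    exact ENat.add_right_injective_of_ne_top (hωfin _ han) hν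

end MatrixDet

/-! ### Principal reductions of ideals -/

section Reduction

open nonZeroDivisors

variable {R : Type*} [CommRing R]

/-- `g / d` is integral over `R` in the total ring of fractions, i.e. `g` is integral over the ideal
generated by `d`. -/
def IntegralOver (g d : R) : Prop :=
  ∃ y : FractionRing R, IsIntegral R y ∧
    algebraMap R (FractionRing R) g = algebraMap R (FractionRing R) d * y

theorem IntegralOver.trans {g d d' : R} (h : IntegralOver g d) (h' : IntegralOver d d') :
    IntegralOver g d' := by
  obtain ⟨y, hy, e⟩ := h
  obtain ⟨y', hy', e'⟩ := h'
  exact ⟨y' * y, hy'.mul hy, by rw [e, e', mul_assoc]⟩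

variable [Algebra ℂ R] [IsCurveRing R]

theorem IsCurveRing.isUnit_of_sub_mem {x : R} {a : ℂ} (ha : a ≠ 0)
    (h : x - algebraMap ℂ R a ∈ IsLocalRing.maximalIdeal R) : IsUnit x := by
  by_contra hx
  have h1 : x ∈ IsLocalRing.maximalIdeal R := hx
  have h2 : algebraMap ℂ R a ∈ IsLocalRing.maximalIdeal R := by
    have := Ideal.sub_mem _ h1 h
    rwa [sub_sub_cancel] at this
  exact h2 ((IsUnit.mk0 a ha).map (algebraMap ℂ R))

/-- Multiplication by a nonzerodivisor has a cokernel of the same length on `R` and on an ideal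
of finite colength. -/
theorem cokerLength_lsmul_ideal {t : R} (ht : t ∈ R⁰) (H : Ideal R) {c : R} (hc : c ∈ R⁰)
    (hcH : c ∈ H) : cokerLength (LinearMap.lsmul R H t) = cokerLength (LinearMap.lsmul R R t) := by
  have hfin : cokerLength H.subtype ≠ ⊤ := by
    obtain ⟨N, hN⟩ := exists_pow_maximalIdeal_le_span hc
    have := finite_quotient_of_pow_maximalIdeal_le
      (hN.trans ((Ideal.span_singleton_le_iff_mem H).2 hcH))
    unfold cokerLength
    rw [Submodule.range_subtype, Module.length_eq_finrank]
    exact ENat.natCast_ne_top _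
  -- The map `h ↦ t h` from `H` to `R` factors through the inclusion in two ways; the finite
  -- colength of `H` cancels from the two lengths.
  have h1 := cokerLength_comp H.subtype (LinearMap.lsmul R H t) H.injective_subtype
  have h2 := cokerLength_comp (LinearMap.lsmul R R t) H.subtype (lsmul_injective ht)
  have h3 : H.subtype ∘ₗ LinearMap.lsmul R H t = LinearMap.lsmul R R t ∘ₗ H.subtype := by
    ext
    simp
  rw [h3, h2, add_comm] at h1
  exact (ENat.add_right_injective_of_ne_top hfin h1).symm

/-- Two elements, one of them a nonzerodivisor, satisfy a homogeneous relation which is nontrivial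
modulo the maximal ideal. -/
theorem exists_homogeneous_relation {g₁ : R} (hg₁ : g₁ ∈ R⁰) (g₂ : R) :
    ∃ (n : ℕ) (a : Fin (n + 1) → ℂ) (c : Fin (n + 1) → R), (∃ i, a i ≠ 0) ∧
      (∀ i, c i - algebraMap ℂ R (a i) ∈ IsLocalRing.maximalIdeal R) ∧
      ∑ i : Fin (n + 1), c i * (g₁ ^ (i : ℕ) * g₂ ^ (n - i)) = 0 := by
  obtain ⟨t, htm, ht⟩ := exists_mem_maximalIdeal_nonZeroDivisors (R := R)
  -- The degree `n` is the length of `R / tR`, which is also that of `H / tH`; hence the `n + 1`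
  -- monomials generating `H` are linearly dependent there.
  obtain ⟨n, hn⟩ := ENat.ne_top_iff_exists.1 (cokerLength_lsmul_ne_top ht)
  let v : Fin (n + 1) → R := fun i => g₁ ^ (i : ℕ) * g₂ ^ (n - i)
  let H : Ideal R := Ideal.span (Set.range v)
  have hv : ∀ i, v i ∈ H := fun i => Ideal.subset_span ⟨i, rfl⟩
  have hcH : g₁ ^ n ∈ H := by
    have := hv (Fin.last n)
    simpa [v] using this
  have hlen := cokerLength_lsmul_ideal ht H (pow_mem hg₁ n) hcH
  rw [← hn] at hlen
  unfold cokerLength at hlen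
  have hfl : IsFiniteLength ℂ (H ⧸ LinearMap.range (LinearMap.lsmul R H t)) :=
    Module.length_ne_top_iff.1 (hlen ▸ ENat.natCast_ne_top _)
  have hnoeth := (isFiniteLength_iff_isNoetherian_isArtinian.1 hfl).1
  have hfr : Module.finrank ℂ (H ⧸ LinearMap.range (LinearMap.lsmul R H t)) = n := by
    rw [Module.length_eq_finrank] at hlen
    exact_mod_cast hlen
  let w : Fin (n + 1) → H ⧸ LinearMap.range (LinearMap.lsmul R H t) :=
    fun i => Submodule.Quotient.mk ⟨v i, hv i⟩
  have hdep : ¬ LinearIndependent ℂ w := by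
    intro h
    have := h.fintype_card_le_finrank
    rw [hfr, Fintype.card_fin] at this
    omega
  obtain ⟨a, ha, hne⟩ := Fintype.not_linearIndependent_iff.1 hdep
  have hmem : (∑ i, algebraMap ℂ R (a i) • (⟨v i, hv i⟩ : H)) ∈
      LinearMap.range (LinearMap.lsmul R H t) := by
    rw [← Submodule.Quotient.mk_eq_zero, ← ha, ← Submodule.mkQ_apply, map_sum]
    refine Finset.sum_congr rfl fun i _ => ?_
    rw [map_smul, algebraMap_smul]
    rfl
  obtain ⟨h, hh⟩ := hmem
  obtain ⟨b, hb⟩ := (Submodule.mem_span_range_iff_exists_fun R).1 h.2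
  have hh' : t * (h : R) = ∑ i, algebraMap ℂ R (a i) * v i := by
    have := congrArg (Subtype.val) hh
    simpa [← Algebra.smul_def] using this
  -- The dependent combination lies in `t H`, so it is `t` times a combination of the same
  -- monomials; subtracting this alters coefficients only modulo the maximal ideal.
  refine ⟨n, a, fun i => algebraMap ℂ R (a i) - t * b i, hne, fun i => ?_, ?_⟩
  · rw [sub_right_comm, sub_self, zero_sub]
    exact neg_mem (Ideal.mul_mem_right _ _ htm)
  · change ∑ i, (algebraMap ℂ R (a i) - t * b i) * v i = 0
    simp only [sub_mul, Finset.sum_sub_distrib]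
    rw [← hh', ← hb, Finset.mul_sum, sub_eq_zero]
    refine Finset.sum_congr rfl fun i _ => ?_
    rw [smul_eq_mul, mul_assoc]

/-- A general member `z = g₁ - σ g₂` of the pencil works: divided by `zⁿ`, the homogeneous relation
becomes an equation for `g₂ / z` whose leading coefficient `∑ cᵢ σⁱ` is a unit for all but finitely
many constants `σ`. -/
theorem exists_integralOver_pair {g₁ : R} (hg₁ : g₁ ∈ R⁰) (g₂ : R) :
    ∃ z ∈ R⁰, z ∈ Ideal.span {g₁, g₂} ∧ IntegralOver g₁ z ∧ IntegralOver g₂ z := by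
  obtain ⟨n, a, c, ⟨j, hj⟩, hac, hrel⟩ := exists_homogeneous_relation hg₁ g₂
  let φ : Polynomial ℂ := ∑ i : Fin (n + 1), Polynomial.monomial (i : ℕ) (a i)
  have hφ : φ ≠ 0 := by
    intro h0
    have h1 : φ.coeff j = 0 := by rw [h0, Polynomial.coeff_zero]
    simp only [φ, Polynomial.finsetSum_coeff, Polynomial.coeff_monomial] at h1
    rw [Finset.sum_eq_single j (fun i _ hij => by rw [if_neg fun h => hij (Fin.ext h)])
      (by simp), if_pos rfl] at h1
    exact hj h1
  obtain ⟨s, hs⟩ := Infinite.exists_notMem_finset φ.roots.toFinset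
  have hs0 : ∑ i : Fin (n + 1), a i * s ^ (i : ℕ) ≠ 0 := by
    intro h0
    refine hs (Multiset.mem_toFinset.2 ((Polynomial.mem_roots hφ).2 ?_))
    simpa [φ, Polynomial.eval_finsetSum] using h0
  set σ := algebraMap ℂ R s with hσ
  set u := ∑ i : Fin (n + 1), c i * σ ^ (i : ℕ) with hu
  have hunit : IsUnit u := by
    refine IsCurveRing.isUnit_of_sub_mem hs0 ?_
    rw [hu, map_sum, ← Finset.sum_sub_distrib]
    refine Ideal.sum_mem _ fun i _ => ?_
    rw [map_mul, map_pow, ← sub_mul]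
    exact Ideal.mul_mem_right _ _ (hac i)
  set z := g₁ - σ * g₂ with hz
  -- Modulo `z` one has `g₁ = σ g₂`, so the relation reads `u g₂ⁿ = 0`. It follows that `z` divides
  -- `g₁ⁿ` too and is a nonzerodivisor.
  have hz2 : z ∣ g₂ ^ n := by
    have h1 : z ∣ ∑ i : Fin (n + 1), c i * (g₁ ^ (i : ℕ) * g₂ ^ (n - i)) - u * g₂ ^ n := by
      rw [hu, Finset.sum_mul, ← Finset.sum_sub_distrib]
      refine Finset.dvd_sum fun i _ => ?_
      have h2 : g₂ ^ n = g₂ ^ (i : ℕ) * g₂ ^ (n - i) := by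
        rw [← pow_add]
        congr 1
        omega
      have h3 : c i * (g₁ ^ (i : ℕ) * g₂ ^ (n - i)) - c i * σ ^ (i : ℕ) * g₂ ^ n =
          (g₁ ^ (i : ℕ) - (σ * g₂) ^ (i : ℕ)) * (c i * g₂ ^ (n - i)) := by
        rw [h2]; ring
      rw [h3]
      exact (sub_dvd_pow_sub_pow _ _ _).mul_right _
    rw [hrel, zero_sub, dvd_neg] at h1
    exact hunit.dvd_mul_left.1 h1
  have hz1 : z ∣ g₁ ^ n := by
    have h1 : z ∣ g₁ ^ n - (σ * g₂) ^ n := sub_dvd_pow_sub_pow _ _ _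
    rw [mul_pow] at h1
    exact (dvd_sub_left (hz2.mul_left _)).1 h1
  have hznzd : z ∈ R⁰ := by
    obtain ⟨x, hx⟩ := hz1
    exact (mul_mem_nonZeroDivisors.1 (hx ▸ pow_mem hg₁ n)).1
  let y : FractionRing R := IsLocalization.mk' (FractionRing R) g₂ ⟨z, hznzd⟩
  have hy : algebraMap R (FractionRing R) g₂ = algebraMap R (FractionRing R) z * y :=
    (IsLocalization.mk'_spec' (FractionRing R) g₂ ⟨z, hznzd⟩).symm
  have hzu : IsUnit (algebraMap R (FractionRing R) z) := IsLocalization.map_units (FractionRing R) (⟨z, hznzd⟩ : R⁰)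
  have hg1 : algebraMap R (FractionRing R) g₁ = algebraMap R (FractionRing R) z * (1 + algebraMap R (FractionRing R) σ * y) := by
    have : g₁ = z + σ * g₂ := by rw [hz]; ring
    rw [this, map_add, map_mul, hy]
    ring
  -- Substituting `g₂ = z y` and `g₁ = z (1 + σ y)` turns the relation into `zⁿ p(y) = 0`, where `p`
  -- has degree at most `n` and `n`-th coefficient the unit `u`.
  have hyint : IsIntegral R y := by
    let p : Polynomial R := ∑ i : Fin (n + 1), Polynomial.C (c i) *
      ((Polynomial.C σ * Polynomial.X + Polynomial.C 1) ^ (i : ℕ) * Polynomial.X ^ (n - i))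
    have hdeg : ∀ i : Fin (n + 1),
        Polynomial.natDegree ((Polynomial.C σ * Polynomial.X + Polynomial.C 1) ^ (i : ℕ)) ≤
          (i : ℕ) := by
      intro i
      exact (Polynomial.natDegree_pow_le_of_le (i : ℕ)
        (Polynomial.natDegree_linear_le (a := σ) (b := 1))).trans (by simp)
    have hpdeg : p.natDegree ≤ n := by
      refine Polynomial.natDegree_sum_le_of_forall_le _ _ fun i _ => ?_
      refine (Polynomial.natDegree_C_mul_le _ _).trans
        ((Polynomial.natDegree_mul_le_of_le (hdeg i) (Polynomial.natDegree_X_pow_le _)).trans ?_)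
      omega
    have hpc : p.coeff n = u := by
      simp only [p, Polynomial.finsetSum_coeff, Polynomial.coeff_C_mul, hu]
      refine Finset.sum_congr rfl fun i _ => ?_
      congr 1
      rw [Polynomial.coeff_mul_X_pow', if_pos (Nat.sub_le _ _),
        show n - (n - (i : ℕ)) = i by omega]
      have := Polynomial.coeff_pow_of_natDegree_le (m := (i : ℕ))
        (Polynomial.natDegree_linear_le (a := σ) (b := 1))
      rw [mul_one] at this
      rw [this]
      simp [Polynomial.coeff_one]
    obtain ⟨u', hu'⟩ := hunit
    refine ⟨Polynomial.C (↑u'⁻¹ : R) * p, ?_, ?_⟩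
    · refine Polynomial.monic_of_natDegree_le_of_coeff_eq_one n
        ((Polynomial.natDegree_C_mul_le _ _).trans hpdeg) ?_
      rw [Polynomial.coeff_C_mul, hpc, ← hu']
      simp
    · have h0 : Polynomial.eval₂ (algebraMap R (FractionRing R)) y p = 0 := by
        refine (hzu.pow n).mul_left_cancel ?_
        rw [mul_zero, ← map_zero (algebraMap R (FractionRing R)), ← hrel, map_sum]
        simp only [p, Polynomial.eval₂_finsetSum, Finset.mul_sum]
        refine Finset.sum_congr rfl fun i _ => ?_
        simp only [Polynomial.eval₂_mul, Polynomial.eval₂_C, Polynomial.eval₂_pow,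
          Polynomial.eval₂_add, Polynomial.eval₂_X, Polynomial.eval₂_one, map_mul, map_pow, map_one]
        rw [hg1, hy, mul_pow, mul_pow]
        have hni : (algebraMap R (FractionRing R) z) ^ n =
            (algebraMap R (FractionRing R) z) ^ (i : ℕ) * (algebraMap R (FractionRing R) z) ^ (n - i) := by
          rw [← pow_add]
          congr 1
          omega
        rw [hni]
        ring
      rw [Polynomial.eval₂_mul, h0, mul_zero]
  refine ⟨z, hznzd, ?_, ⟨_, isIntegral_one.add (isIntegral_algebraMap.mul hyint), hg1⟩,
    ⟨y, hyint, hy⟩⟩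
  exact Ideal.sub_mem _ (Ideal.subset_span (by simp))
    (Ideal.mul_mem_left _ _ (Ideal.subset_span (by simp)))

/-- The pencil argument absorbs one generator at a time, and integrality is transitive along the
successive elements. Finiteness of the normalization is not needed. -/
theorem exists_integralOver_finset {g₀ : R} (hg₀ : g₀ ∈ R⁰) (G : Finset R) :
    ∃ d ∈ R⁰, d ∈ Ideal.span (insert g₀ (G : Set R)) ∧ IntegralOver g₀ d ∧
      ∀ g ∈ G, IntegralOver g d := by
  classical
  induction G using Finset.induction_on with
  | empty => exact ⟨g₀, hg₀, Ideal.subset_span (by simp), ⟨1, isIntegral_one, by simp⟩, by simp⟩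
  | insert g G _ ih =>
    obtain ⟨d, hd, hdm, h₀, hG⟩ := ih
    obtain ⟨z, hz, hzm, h1, h2⟩ := exists_integralOver_pair hd g
    refine ⟨z, hz, ?_, h₀.trans h1, fun x hx => ?_⟩
    · refine (Ideal.span_le.2 ?_) hzm
      rintro x (rfl | rfl)
      · refine Ideal.span_mono ?_ hdm
        exact Set.insert_subset_insert (by simp)
      · exact Ideal.subset_span (by simp)
    · rcases Finset.mem_insert.1 hx with rfl | hx
      · exact h2
      · exact (hG x hx).trans h1

end Reduction

/-! ### Generic linear combinations generate reductions -/

section GenericReduction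

open nonZeroDivisors

variable {R : Type*} [CommRing R] [Algebra ℂ R] [IsCurveRing R]

/-- Residue fields of finite algebras over the local ring of a curve are `ℂ`. -/
theorem exists_ringHom_ker_eq {S : Type*} [CommRing S] [Algebra R S] [Module.Finite R S]
    (𝔫 : Ideal S) [𝔫.IsMaximal] : ∃ χ : S →+* ℂ, RingHom.ker χ = 𝔫 ∧
      ∀ a : ℂ, χ (algebraMap R S (algebraMap ℂ R a)) = a := by
  let _ : Field (S ⧸ 𝔫) := Ideal.Quotient.field 𝔫
  let f : ℂ →+* S ⧸ 𝔫 :=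
    (Ideal.Quotient.mk 𝔫).comp ((algebraMap R S).comp (algebraMap ℂ R))
  let _ : Algebra ℂ (S ⧸ 𝔫) := f.toAlgebra
  have hmax : 𝔫.comap (algebraMap R S) = IsLocalRing.maximalIdeal R :=
    IsLocalRing.eq_maximalIdeal (Ideal.isMaximal_comap_of_isIntegral_of_isMaximal 𝔫)
  have hres : ∀ r : R, ∃ a : ℂ, Ideal.Quotient.mk 𝔫 (algebraMap R S r) = f a := by
    intro r
    obtain ⟨a, ha⟩ := IsCurveRing.exists_sub_mem r
    refine ⟨a, ?_⟩
    rw [← hmax, Ideal.mem_comap, map_sub] at ha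
    exact Ideal.Quotient.eq.2 ha
  -- Elements of `R` act on the residue field through constants, so a monic equation over `R`
  -- becomes a monic equation over `ℂ`.
  have hint : Algebra.IsIntegral ℂ (S ⧸ 𝔫) := by
    refine ⟨fun x => ?_⟩
    obtain ⟨x, rfl⟩ := Ideal.Quotient.mk_surjective x
    obtain ⟨p, hp, hpx⟩ := Algebra.IsIntegral.isIntegral (R := R) x
    have hlift : p.map ((Ideal.Quotient.mk 𝔫).comp (algebraMap R S)) ∈ Polynomial.lifts f := by
      rw [Polynomial.lifts_iff_coeff_lifts]
      intro i
      obtain ⟨a, ha⟩ := hres (p.coeff i)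
      exact ⟨a, by rw [← ha, Polynomial.coeff_map]; rfl⟩
    obtain ⟨q, hq, -, hqm⟩ := Polynomial.lifts_and_degree_eq_and_monic hlift (hp.map _)
    refine ⟨q, hqm, ?_⟩
    change Polynomial.eval₂ f _ q = 0
    rw [← Polynomial.eval_map, hq, Polynomial.eval_map,
      ← Polynomial.hom_eval₂, hpx, map_zero]
  let e : ℂ ≃+* S ⧸ 𝔫 :=
    RingEquiv.ofBijective (algebraMap ℂ (S ⧸ 𝔫)) IsAlgClosed.algebraMap_bijective_of_isIntegral
  refine ⟨(e.symm : S ⧸ 𝔫 →+* ℂ).comp (Ideal.Quotient.mk 𝔫), ?_, fun a => ?_⟩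
  · ext x
    simp [RingHom.mem_ker, Ideal.Quotient.eq_zero_iff_mem]
  · exact e.symm_apply_apply a

/-- By integrality all maximal ideals of `S` lie over the maximal ideal of `R`, and a finite algebra
has finitely many primes over a given one. -/
theorem finite_maximalSpectrum_of_finite (S : Type*) [CommRing S] [Algebra R S]
    [Module.Finite R S] : Finite (MaximalSpectrum S) := by
  have hfin := Algebra.QuasiFinite.finite_primesOver (S := S) (IsLocalRing.maximalIdeal R)
  have := hfin.to_subtype
  refine Finite.of_injective (β := (IsLocalRing.maximalIdeal R).primesOver S)
    (fun 𝔫 => ⟨𝔫.asIdeal, 𝔫.isMaximal.isPrime, ⟨?_⟩⟩) fun x y h => ?_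
  · have := 𝔫.isMaximal
    exact (IsLocalRing.eq_maximalIdeal
      (Ideal.isMaximal_comap_of_isIntegral_of_isMaximal 𝔫.asIdeal)).symm
  · exact MaximalSpectrum.ext (congrArg Subtype.val h)

/-- A linear combination of generators of an ideal `J`, with coefficients outside finitely many
hyperplanes, generates a reduction of `J`. -/
theorem exists_generic_reduction {κ : Type*} [Fintype κ] (g : κ → R)
    (hg : ∃ g₀ ∈ R⁰, g₀ ∈ Ideal.span (Set.range g)) :
    ∃ (Q : Set (κ → ℂ)) (c : R), Q.Finite ∧ (∀ q ∈ Q, q ≠ 0) ∧ c ∈ R⁰ ∧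
      ∀ α : κ → ℂ, (∀ q ∈ Q, ∑ k, α k * q k ≠ 0) →
        ∑ k, algebraMap ℂ R (α k) * g k ∈ R⁰ ∧
        ∀ l : ℕ, ∀ x ∈ Ideal.span (Set.range g) ^ l,
          (∑ k, algebraMap ℂ R (α k) * g k) ^ l ∣ c * x := by
  classical
  obtain ⟨g₀, hg₀, hg₀m⟩ := hg
  obtain ⟨d, hd, hdm, -, hG⟩ := exists_integralOver_finset hg₀ (Finset.univ.image g)
  have hdJ : d ∈ Ideal.span (Set.range g) := by
    refine (Ideal.span_le.2 ?_) hdm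
    rintro x (rfl | hx)
    · exact hg₀m
    · exact Ideal.subset_span (by simpa using hx)
  choose y hy hgy using fun k => hG (g k) (by simp)
  -- In this finite extension of `R` inside the total ring of fractions, the ideal `J` generated by
  -- the `g k = d y_k` satisfies `J S = d S`.
  let S := Algebra.adjoin R (Set.range y)
  have hfinS : Module.Finite R S := Algebra.finite_adjoin_of_finite_of_isIntegral
    (Set.finite_range y) (by rintro _ ⟨k, rfl⟩; exact hy k)
  let yS : κ → S := fun k => ⟨y k, Algebra.subset_adjoin ⟨k, rfl⟩⟩
  have hdu : IsUnit (algebraMap R (FractionRing R) d) :=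
    IsLocalization.map_units (FractionRing R) (⟨d, hd⟩ : R⁰)
  have hinj : Function.Injective (algebraMap R (FractionRing R)) :=
    IsLocalization.injective _ le_rfl
  -- Write `d ∈ J` as `∑ r_k g_k = d ∑ r_k y_k` and cancel `d`.
  have hone : (1 : S) ∈ Ideal.span (Set.range yS) := by
    obtain ⟨r, hr⟩ := (Submodule.mem_span_range_iff_exists_fun R).1 hdJ
    have h1 : (1 : S) = ∑ k, algebraMap R S (r k) * yS k := by
      refine Subtype.ext (hdu.mul_left_cancel ?_)
      rw [← hr] at hdu ⊢
      simp only [smul_eq_mul, map_sum, map_mul, OneMemClass.coe_one, mul_one,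
        AddSubmonoidClass.coe_finsetSum, MulMemClass.coe_mul]
      rw [Finset.mul_sum]
      refine Finset.sum_congr rfl fun k _ => ?_
      rw [hgy, ← hr]
      simp only [smul_eq_mul, map_sum, map_mul]
      change _ = _ * (algebraMap R (FractionRing R) (r k) * y k)
      ring
    rw [h1]
    exact Ideal.sum_mem _ fun k _ => Ideal.mul_mem_left _ _ (Ideal.subset_span ⟨k, rfl⟩)
  have hfinM := finite_maximalSpectrum_of_finite (R := R) S
  choose χ hker hχ using fun 𝔫 : MaximalSpectrum S =>
    have := 𝔫.isMaximal
    exists_ringHom_ker_eq (R := R) 𝔫.asIdeal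
  obtain ⟨T, hT⟩ := hfinS.fg_top
  -- A common denominator of module generators of `S`, so that `c S ⊆ R`. It is chosen before `α`
  -- and `l`, hence the later error bounds are uniform.
  obtain ⟨c, hc⟩ := IsLocalization.exist_integer_multiples_of_finset R⁰
    (T.image (Subtype.val : S → FractionRing R))
  have hcS : ∀ s : S, ∃ r : R, algebraMap R (FractionRing R) r =
      algebraMap R (FractionRing R) c * s := by
    intro s
    have hs : s ∈ Submodule.span R (T : Set S) := hT ▸ Submodule.mem_top
    refine Submodule.span_induction (fun x hx => ?_) ⟨0, by simp⟩ ?_ ?_ hs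
    · obtain ⟨r, hr⟩ := hc x (Finset.mem_image_of_mem _ hx)
      exact ⟨r, by rw [hr, Algebra.smul_def]⟩
    · rintro x x' - - ⟨r, hr⟩ ⟨r', hr'⟩
      exact ⟨r + r', by rw [map_add, hr, hr']; push_cast; ring⟩
    · rintro b x - ⟨r, hr⟩
      refine ⟨b * r, ?_⟩
      rw [map_mul, hr, Subalgebra.coe_smul, Algebra.smul_def]
      ring
  -- Each maximal ideal of `S` forbids the hyperplane on which `∑ α_k y_k` vanishes in its residue
  -- field. Off these hyperplanes that sum is a unit `x` of `S`, and `δ = d x` generates `J S`.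
  refine ⟨Set.range fun 𝔫 => fun k => χ 𝔫 (yS k), c, Set.finite_range _, ?_, c.2, fun α hα => ?_⟩
  · rintro _ ⟨𝔫, rfl⟩ h0
    refine 𝔫.isMaximal.ne_top ((Ideal.eq_top_iff_one _).2 ((Ideal.span_le.2 ?_) hone))
    rintro _ ⟨k, rfl⟩
    rw [SetLike.mem_coe, ← hker 𝔫, RingHom.mem_ker]
    exact congrFun h0 k
  · set δ := ∑ k, algebraMap ℂ R (α k) * g k with hδ
    let x : S := ∑ k, algebraMap R S (algebraMap ℂ R (α k)) * yS k
    have hx : IsUnit x := by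
      by_contra hcon
      obtain ⟨𝔫, h𝔫, hx⟩ := exists_max_ideal_of_mem_nonunits hcon
      refine hα _ ⟨⟨𝔫, h𝔫⟩, rfl⟩ ?_
      have h1 : χ ⟨𝔫, h𝔫⟩ x = 0 := by
        rw [← RingHom.mem_ker, hker]
        exact hx
      rw [← h1, map_sum]
      refine Finset.sum_congr rfl fun k _ => ?_
      rw [map_mul, hχ]
    have hδx : algebraMap R (FractionRing R) δ = algebraMap R (FractionRing R) d * x := by
      have h1 : (x : FractionRing R) =
          ∑ k, algebraMap R (FractionRing R) (algebraMap ℂ R (α k)) * y k := by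
        simp only [x, AddSubmonoidClass.coe_finsetSum, MulMemClass.coe_mul]
        rfl
      rw [h1, hδ, map_sum, Finset.mul_sum]
      refine Finset.sum_congr rfl fun k _ => ?_
      rw [map_mul, hgy]
      ring
    have hδu : IsUnit (algebraMap R (FractionRing R) δ) := by
      rw [hδx]
      exact hdu.mul (hx.map S.val)
    have hdvd : ∀ l : ℕ, ∀ z ∈ Ideal.span (Set.range g) ^ l, ∃ s : S,
        algebraMap R (FractionRing R) z = algebraMap R (FractionRing R) δ ^ l * s := by
      have hadd : ∀ l : ℕ, ∀ z z' : R, (∃ s : S,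
          algebraMap R (FractionRing R) z = algebraMap R (FractionRing R) δ ^ l * s) → (∃ s : S,
          algebraMap R (FractionRing R) z' = algebraMap R (FractionRing R) δ ^ l * s) → ∃ s : S,
          algebraMap R (FractionRing R) (z + z') = algebraMap R (FractionRing R) δ ^ l * s := by
        rintro l z z' ⟨s, hs⟩ ⟨s', hs'⟩
        exact ⟨s + s', by rw [map_add, hs, hs']; push_cast; ring⟩
      have h1 : ∀ z ∈ Ideal.span (Set.range g), ∃ s : S,
          algebraMap R (FractionRing R) z = algebraMap R (FractionRing R) δ ^ 1 * s := by
        intro z hz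
        refine Submodule.span_induction ?_ ⟨0, by simp⟩ (fun z z' _ _ => hadd 1 z z') ?_ hz
        · rintro _ ⟨k, rfl⟩
          refine ⟨↑hx.unit⁻¹ * yS k, ?_⟩
          have h2 : (x : FractionRing R) * ((↑hx.unit⁻¹ : S) : FractionRing R) = 1 :=
            congrArg (Subtype.val : S → FractionRing R) hx.mul_val_inv
          rw [hgy, pow_one, hδx, MulMemClass.coe_mul]
          linear_combination (-(algebraMap R (FractionRing R) d) * y k) * h2
        · rintro b z - ⟨s, hs⟩
          refine ⟨algebraMap R S b * s, ?_⟩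
          rw [smul_eq_mul, map_mul, hs, MulMemClass.coe_mul]
          change _ = _ * (algebraMap R (FractionRing R) b * _)
          ring
      intro l
      induction l with
      | zero => exact fun z _ => ⟨algebraMap R S z, by rw [pow_zero, one_mul]; rfl⟩
      | succ l ih =>
        intro z hz
        rw [pow_succ] at hz
        refine Submodule.mul_induction_on hz (fun a ha b hb => ?_) (hadd (l + 1))
        obtain ⟨s, hs⟩ := ih a ha
        obtain ⟨s', hs'⟩ := h1 b hb
        refine ⟨s * s', ?_⟩
        rw [map_mul, hs, hs', MulMemClass.coe_mul]
        ring
    refine ⟨?_, fun l z hz => ?_⟩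
    · refine mem_nonZeroDivisors_iff_right.2 fun r hr => hinj ?_
      rw [map_zero]
      refine hδu.mul_right_cancel ?_
      rw [← map_mul, hr, map_zero, zero_mul]
    · obtain ⟨s, hs⟩ := hdvd l z hz
      obtain ⟨r, hr⟩ := hcS s
      refine ⟨r, hinj ?_⟩
      rw [map_mul, map_mul, map_pow, hs, hr]
      ring

end GenericReduction

/-! ### Cauchy–Binet and generic minors -/

section GenericMinor

open nonZeroDivisors

/-- Multilinear expansion along the rows: Cauchy–Binet before grouping, summed over all maps of
indices, including those with repeated rows. -/
theorem det_mul_eq_sum_rows {S κ : Type*} [CommRing S] [Fintype κ] [DecidableEq κ] {e : ℕ}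
    (A : Matrix (Fin e) κ S) (Y : Matrix κ (Fin e) S) :
    (A * Y).det = ∑ I : Fin e → κ, (∏ i, A i (I i)) * (Y.submatrix I id).det := by
  have h : (A * Y) = fun i => ∑ k, A i k • Y k := by
    ext i j
    simp [Matrix.mul_apply]
  change Matrix.detRowAlternating (A * Y) = _
  rw [h]
  refine (Matrix.detRowAlternating.toMultilinearMap.map_sum (fun i k => A i k • Y k)).trans
    (Finset.sum_congr rfl fun I _ => ?_)
  exact Matrix.detRowAlternating.toMultilinearMap.map_smul_univ (fun i => A i (I i))
    fun i => Y (I i)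

theorem det_mul_eq_sum_columns {S κ : Type*} [CommRing S] [Fintype κ] [DecidableEq κ] {e : ℕ}
    (Y : Matrix (Fin e) κ S) (B : Matrix κ (Fin e) S) :
    (Y * B).det = ∑ J : Fin e → κ, (∏ i, B (J i) i) * (Y.submatrix id J).det := by
  rw [← Matrix.det_transpose, Matrix.transpose_mul, det_mul_eq_sum_rows]
  refine Finset.sum_congr rfl fun J _ => ?_
  rw [← Matrix.det_transpose (Y.submatrix id J)]
  rfl

theorem det_mul_mul_eq_sum {S κ κ' : Type*} [CommRing S] [Fintype κ] [DecidableEq κ] [Fintype κ']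
    [DecidableEq κ'] {e : ℕ} (A : Matrix (Fin e) κ S) (Y : Matrix κ κ' S)
    (B : Matrix κ' (Fin e) S) :
    (A * Y * B).det = ∑ IJ : (Fin e → κ) × (Fin e → κ'),
      ((∏ i, A i (IJ.1 i)) * ∏ i, B (IJ.2 i) i) * (Y.submatrix IJ.1 IJ.2).det := by
  rw [Matrix.mul_assoc, det_mul_eq_sum_rows, Fintype.sum_prod_type]
  refine Finset.sum_congr rfl fun I _ => ?_
  have : (Y * B).submatrix I id = Y.submatrix I id * B := by
    ext i j
    simp [Matrix.mul_apply]
  rw [this, det_mul_eq_sum_columns, Finset.mul_sum]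
  refine Finset.sum_congr rfl fun J _ => ?_
  rw [mul_assoc]
  rfl

variable {R : Type*} [CommRing R]

theorem minorsIdeal_eq_span_range {p c₀ : ℕ} (e : ℕ) (M : Submodule R (Fin p → R))
    (X : Matrix (Fin p) (Fin c₀) R) (hX : Submodule.span R (Set.range X.col) = M) :
    minorsIdeal M e = Ideal.span (Set.range fun IJ : (Fin e → Fin p) × (Fin e → Fin c₀) =>
      (X.submatrix IJ.1 IJ.2).det) := by
  have hcol : ∀ j, X.col j ∈ M := fun j => hX ▸ Submodule.subset_span ⟨j, rfl⟩
  refine le_antisymm (Ideal.span_le.2 ?_) (Ideal.span_le.2 ?_)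
  · rintro x ⟨v, r, rfl⟩
    have hv : ∀ j, ∃ b : Fin c₀ → R, ∑ k, b k • X.col k = v j := fun j =>
      (Submodule.mem_span_range_iff_exists_fun R).1 (hX ▸ (v j).2)
    choose b hb using hv
    have h1 : (Matrix.of fun i j => (v j : Fin p → R) (r i)) =
        X.submatrix r id * Matrix.of fun k j => b j k := by
      ext i j
      rw [Matrix.of_apply, ← hb j]
      simp [Matrix.mul_apply, Matrix.col, mul_comm]
    rw [h1, det_mul_eq_sum_columns]
    exact Ideal.sum_mem _ fun J _ => Ideal.mul_mem_left _ _ (Ideal.subset_span ⟨(r, J), rfl⟩)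
  · rintro _ ⟨⟨I, J⟩, rfl⟩
    exact Ideal.subset_span ⟨fun j => ⟨X.col (J j), hcol (J j)⟩, I, rfl⟩

/-- The coefficients with which the minors of `Y` enter into `det (A Y B)`, as polynomials in the
entries of `A` and `B`. -/
noncomputable def minorCoefficient {e p c₀ : ℕ} (IJ : (Fin e → Fin p) × (Fin e → Fin c₀)) :
    MvPolynomial ((Fin e × Fin p) ⊕ (Fin c₀ × Fin e)) ℂ :=
  (∏ i, MvPolynomial.X (Sum.inl (i, IJ.1 i))) * ∏ i, MvPolynomial.X (Sum.inr (IJ.2 i, i))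

theorem eval_minorCoefficient {e p c₀ : ℕ} (IJ : (Fin e → Fin p) × (Fin e → Fin c₀))
    (x : (Fin e × Fin p) ⊕ (Fin c₀ × Fin e) → ℂ) :
    MvPolynomial.eval x (minorCoefficient IJ) =
      (∏ i, x (Sum.inl (i, IJ.1 i))) * ∏ i, x (Sum.inr (IJ.2 i, i)) := by
  simp [minorCoefficient, map_prod]

/-- Evaluating at the zero-one matrices that select the rows `I₀` and the columns `J₀` isolates the
coefficient of that one minor. -/
theorem sum_minorCoefficient_ne_zero {e p c₀ : ℕ}
    {q : (Fin e → Fin p) × (Fin e → Fin c₀) → ℂ} (hq : q ≠ 0) :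
    ∑ IJ, minorCoefficient IJ * MvPolynomial.C (q IJ) ≠ 0 := by
  obtain ⟨⟨I₀, J₀⟩, h0⟩ := Function.ne_iff.1 hq
  intro h
  have h1 := congrArg (MvPolynomial.eval (Sum.elim
    (fun ik : Fin e × Fin p => if ik.2 = I₀ ik.1 then (1 : ℂ) else 0)
    (fun ki : Fin c₀ × Fin e => if ki.1 = J₀ ki.2 then (1 : ℂ) else 0))) h
  rw [map_sum, map_zero, Finset.sum_eq_single (I₀, J₀)] at h1
  · rw [map_mul, eval_minorCoefficient] at h1
    simp at h1
    exact h0 h1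
  · rintro ⟨I, J⟩ - hne
    rw [map_mul, eval_minorCoefficient]
    by_cases hI : I = I₀
    · have hJ : J ≠ J₀ := fun hJ => hne (by rw [hI, hJ])
      obtain ⟨i, hi⟩ := Function.ne_iff.1 hJ
      rw [Finset.prod_eq_zero (i := i) (s := Finset.univ) (f := fun i => Sum.elim _ _ (Sum.inr (J i, i)))
        (Finset.mem_univ i) (by simp [hi])]
      simp
    · obtain ⟨i, hi⟩ := Function.ne_iff.1 hI
      rw [Finset.prod_eq_zero (i := i) (s := Finset.univ) (f := fun i => Sum.elim _ _ (Sum.inl (i, I i)))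
        (Finset.mem_univ i) (by simp [hi])]
      simp
  · simp

variable [Algebra ℂ R] [IsCurveRing R]

/-- For generic `A` and a suitable fixed `B`, the determinant of `A X B` generates a reduction of the
ideal of maximal minors of `X`. -/
theorem exists_generic_minor {p c₀ e : ℕ} (X : Matrix (Fin p) (Fin c₀) R) (J : Ideal R)
    (hJ : J = Ideal.span (Set.range fun IJ : (Fin e → Fin p) × (Fin e → Fin c₀) =>
      (X.submatrix IJ.1 IJ.2).det))
    (hnzd : ∃ g₀ ∈ R⁰, g₀ ∈ J) :
    ∃ (P : MvPolynomial (Fin e × Fin p) ℂ) (B : Matrix (Fin c₀) (Fin e) ℂ) (c : R), P ≠ 0 ∧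
      c ∈ R⁰ ∧ ∀ A : Matrix (Fin e) (Fin p) ℂ,
        MvPolynomial.eval (fun ij => A ij.1 ij.2) P ≠ 0 →
          (A.map (algebraMap ℂ R) * X * B.map (algebraMap ℂ R)).det ∈ R⁰ ∧
          ∀ l : ℕ, ∀ x ∈ J ^ l,
            (A.map (algebraMap ℂ R) * X * B.map (algebraMap ℂ R)).det ^ l ∣ c * x := by
  subst hJ
  obtain ⟨Q, c, hQfin, hQ0, hc, hα⟩ := exists_generic_reduction _ hnzd
  -- `Ψ` is the product of the equations of all forbidden hyperplanes. Freezing `B` at a point where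
  -- `Ψ` does not vanish leaves a nonzero polynomial `P` in the entries of `A` alone.
  let Ψ : MvPolynomial ((Fin e × Fin p) ⊕ (Fin c₀ × Fin e)) ℂ :=
    ∏ q ∈ hQfin.toFinset, ∑ IJ, minorCoefficient IJ * MvPolynomial.C (q IJ)
  have hΨ : Ψ ≠ 0 := Finset.prod_ne_zero_iff.2 fun q hq =>
    sum_minorCoefficient_ne_zero (hQ0 q (hQfin.mem_toFinset.1 hq))
  obtain ⟨x₀, hx₀⟩ : ∃ x, MvPolynomial.eval x Ψ ≠ 0 := by
    by_contra! hcon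
    exact hΨ (MvPolynomial.funext fun x => by rw [hcon x, map_zero])
  let B : Matrix (Fin c₀) (Fin e) ℂ := fun k i => x₀ (Sum.inr (k, i))
  let P : MvPolynomial (Fin e × Fin p) ℂ := MvPolynomial.aeval
    (Sum.elim MvPolynomial.X fun ki => MvPolynomial.C (B ki.1 ki.2)) Ψ
  have hP : ∀ y, MvPolynomial.eval y P =
      MvPolynomial.eval (Sum.elim y fun ki => B ki.1 ki.2) Ψ := by
    intro y
    simp only [P]
    rw [← MvPolynomial.coe_aeval_eq_eval, ← MvPolynomial.coe_aeval_eq_eval, RingHom.coe_coe,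
      RingHom.coe_coe, ← AlgHom.comp_apply]
    congr 1
    refine MvPolynomial.algHom_ext fun i => ?_
    rcases i with i | i
    · simp
    · simp
  refine ⟨P, B, c, ?_, hc, fun A hA => ?_⟩
  · intro h0
    have h1 := hP (fun ik => x₀ (Sum.inl ik))
    rw [h0, map_zero] at h1
    refine hx₀ ?_
    rw [h1]
    congr 2
    ext i
    rcases i with i | i <;> rfl
  · rw [hP, map_prod, Finset.prod_ne_zero_iff] at hA
    have hdet : (A.map (algebraMap ℂ R) * X * B.map (algebraMap ℂ R)).det =
        ∑ IJ : (Fin e → Fin p) × (Fin e → Fin c₀),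
          algebraMap ℂ R ((∏ i, A i (IJ.1 i)) * ∏ i, B (IJ.2 i) i) *
            (X.submatrix IJ.1 IJ.2).det := by
      rw [det_mul_mul_eq_sum]
      simp [map_prod]
    rw [hdet]
    refine hα _ fun q hq => ?_
    have h1 := hA q (hQfin.mem_toFinset.2 hq)
    simpa [map_sum, eval_minorCoefficient] using h1

end GenericMinor

/-! ### Symmetric powers as spaces of forms, and linear substitutions -/

section FormsSubstitution

open nonZeroDivisors

variable {R : Type*} [CommRing R] {e : ℕ}

/-- The linear form with a given coefficient vector. -/
noncomputable def linearForm : (Fin e → R) →ₗ[R] MvPolynomial (Fin e) R :=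
  (Pi.basisFun R (Fin e)).constr R MvPolynomial.X

theorem linearForm_apply (v : Fin e → R) : linearForm v = ∑ i, v i • MvPolynomial.X i := by
  simp [linearForm, Module.Basis.constr_apply_fintype]

/-- The forms of degree `l` which are combinations of products of `l` linear forms with coefficient
vectors in `N`. -/
noncomputable def formsOf (N : Submodule R (Fin e → R)) (l : ℕ) :
    Submodule R (MvPolynomial (Fin e) R) :=
  (N.map linearForm) ^ l

theorem formsOf_mono {N N' : Submodule R (Fin e → R)} (h : N ≤ N') (l : ℕ) :
    formsOf N l ≤ formsOf N' l :=
  pow_le_pow_left' (Submodule.map_mono h) l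

theorem formsOf_top (l : ℕ) :
    formsOf (⊤ : Submodule R (Fin e → R)) l = MvPolynomial.homogeneousSubmodule (Fin e) R l := by
  rw [← MvPolynomial.homogeneousSubmodule_one_pow, formsOf,
    MvPolynomial.homogeneousSubmodule_one_eq_span_X, Submodule.map_top]
  congr 1
  rw [linearForm, Module.Basis.constr_range]

/-- The linear substitution with matrix `A`. -/
noncomputable def linearSubst (A : Matrix (Fin e) (Fin e) R) :
    MvPolynomial (Fin e) R →ₐ[R] MvPolynomial (Fin e) R :=
  MvPolynomial.aeval fun j => linearForm (A.col j)

theorem linearSubst_linearForm (A : Matrix (Fin e) (Fin e) R) (v : Fin e → R) :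
    linearSubst A (linearForm v) = linearForm (A.mulVec v) := by
  have h : (linearSubst A).toLinearMap ∘ₗ linearForm = linearForm ∘ₗ A.mulVecLin := by
    refine (Pi.basisFun R (Fin e)).ext fun j => ?_
    simp [linearSubst, linearForm_apply, Matrix.col]
  exact LinearMap.congr_fun h v

theorem linearSubst_mul (A B : Matrix (Fin e) (Fin e) R) :
    linearSubst (A * B) = (linearSubst A).comp (linearSubst B) := by
  refine MvPolynomial.algHom_ext fun j => ?_
  have h1 : ∀ C : Matrix (Fin e) (Fin e) R, linearSubst C (MvPolynomial.X j) = linearForm (C.col j) :=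
    fun C => by simp [linearSubst]
  rw [AlgHom.comp_apply, h1, h1, linearSubst_linearForm]
  rfl

theorem map_linearSubst_formsOf (A : Matrix (Fin e) (Fin e) R) (N : Submodule R (Fin e → R))
    (l : ℕ) : (formsOf N l).map (linearSubst A).toLinearMap = formsOf (N.map A.mulVecLin) l := by
  rw [formsOf, formsOf, Submodule.map_pow]
  congr 1
  rw [← Submodule.map_comp, ← Submodule.map_comp]
  congr 1
  ext v
  simp [linearSubst_linearForm]

theorem linearSubst_mem (A : Matrix (Fin e) (Fin e) R) {l : ℕ} {x : MvPolynomial (Fin e) R}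
    (hx : x ∈ MvPolynomial.homogeneousSubmodule (Fin e) R l) :
    (linearSubst A).toLinearMap x ∈ MvPolynomial.homogeneousSubmodule (Fin e) R l := by
  rw [← formsOf_top] at hx ⊢
  have h1 := Submodule.mem_map_of_mem (f := (linearSubst A).toLinearMap) hx
  rw [map_linearSubst_formsOf] at h1
  exact formsOf_mono le_top l h1

/-- The linear substitution with matrix `A` on forms of degree `l`. -/
noncomputable def substForms (l : ℕ) (A : Matrix (Fin e) (Fin e) R) :
    MvPolynomial.homogeneousSubmodule (Fin e) R l →ₗ[R]
      MvPolynomial.homogeneousSubmodule (Fin e) R l :=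
  (linearSubst A).toLinearMap.restrict fun _ => linearSubst_mem A

theorem substForms_mul (l : ℕ) (A B : Matrix (Fin e) (Fin e) R) :
    substForms l (A * B) = substForms l A ∘ₗ substForms l B := by
  ext x : 2
  simp [substForms, linearSubst_mul]

theorem substForms_smul_one (l : ℕ) (a : R) :
    substForms l (a • (1 : Matrix (Fin e) (Fin e) R)) = LinearMap.lsmul R _ (a ^ l) := by
  ext ⟨x, hx⟩ : 2
  have h : ∀ j, linearForm ((a • (1 : Matrix (Fin e) (Fin e) R)).col j) =
      a • MvPolynomial.X j := by
    intro j
    rw [linearForm_apply, Finset.sum_eq_single j]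
    · simp [Matrix.col]
    · intro i _ hij
      simp [Matrix.col, Matrix.one_apply_ne hij]
    · simp
  change linearSubst _ x = a ^ l • x
  rw [linearSubst, MvPolynomial.aeval_def, MvPolynomial.eval₂_eq']
  conv_rhs => rw [MvPolynomial.as_sum x, Finset.smul_sum]
  refine Finset.sum_congr rfl fun m hm => ?_
  have hdeg : ∑ i, m i = l := by
    rw [← Finsupp.degree_eq_sum]
    by_contra hne
    exact (MvPolynomial.mem_support_iff.1 hm)
      (MvPolynomial.IsHomogeneous.coeff_eq_zero (φ := x) hx hne)
  simp only [h, smul_pow, Finset.prod_smul, Finset.prod_pow_eq_pow_sum, hdeg]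
  rw [MvPolynomial.monomial_eq, Finsupp.prod_fintype _ _ (by simp), mul_smul_comm]
  rfl

theorem mvPolynomial_smul_injective {a : R} (ha : a ∈ R⁰) :
    Function.Injective (LinearMap.lsmul R (MvPolynomial (Fin e) R) a) := by
  rw [injective_iff_map_eq_zero]
  intro x hx
  ext m
  have h1 := congrArg (MvPolynomial.coeff m) hx
  simp only [LinearMap.lsmul_apply, MvPolynomial.coeff_smul, MvPolynomial.coeff_zero,
    smul_eq_mul] at h1
  rw [MvPolynomial.coeff_zero]
  exact (mem_nonZeroDivisors_iff_left.1 ha) _ h1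

theorem homogeneous_smul_injective {a : R} (ha : a ∈ R⁰) (l : ℕ) : Function.Injective
    (LinearMap.lsmul R (MvPolynomial.homogeneousSubmodule (Fin e) R l) a) := fun _ _ h =>
  Subtype.ext (mvPolynomial_smul_injective ha (congrArg Subtype.val h))

/-- Composition with the adjugate is the scalar substitution by `A.det`, which multiplies forms of
degree `l` by the nonzerodivisor `A.det ^ l`. -/
theorem substForms_injective (l : ℕ) {A : Matrix (Fin e) (Fin e) R} (hA : A.det ∈ R⁰) :
    Function.Injective (substForms l A) := by
  have h : substForms l A.adjugate ∘ₗ substForms l A = LinearMap.lsmul R _ (A.det ^ l) := by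
    rw [← substForms_mul, Matrix.adjugate_mul, substForms_smul_one]
  have hinj := homogeneous_smul_injective (e := e) (pow_mem hA l) l
  rw [← h, LinearMap.coe_comp] at hinj
  exact hinj.of_comp

theorem substForms_surjective (l : ℕ) {A : Matrix (Fin e) (Fin e) R} (hA : IsUnit A.det) :
    Function.Surjective (substForms l A) := by
  have h : substForms l A ∘ₗ substForms l A⁻¹ = LinearMap.lsmul R _ ((1 : R) ^ l) := by
    rw [← substForms_mul, Matrix.mul_nonsing_inv _ hA, ← substForms_smul_one, one_smul]
  intro x
  refine ⟨substForms l A⁻¹ x, ?_⟩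
  have := LinearMap.congr_fun h x
  simpa using this

theorem map_range_substForms (l : ℕ) (A : Matrix (Fin e) (Fin e) R) :
    (LinearMap.range (substForms l A)).map
      (MvPolynomial.homogeneousSubmodule (Fin e) R l).subtype =
        formsOf (LinearMap.range A.mulVecLin) l := by
  rw [← Submodule.map_top A.mulVecLin, ← map_linearSubst_formsOf, formsOf_top,
    ← LinearMap.range_comp]
  ext x
  simp only [LinearMap.mem_range, Submodule.mem_map]
  constructor
  · rintro ⟨y, rfl⟩
    exact ⟨y, y.2, rfl⟩
  · rintro ⟨y, hy, rfl⟩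
    exact ⟨⟨y, hy⟩, rfl⟩

variable (R e) in
/-- The forms of degree `l` are a free module of rank the number of monomials of degree `l`. -/
theorem exists_pi_equiv_homogeneousSubmodule (l : ℕ) :
    Nonempty ((((Finset.univ : Finset (Fin e)).finsuppAntidiag l) → R) ≃ₗ[R]
      MvPolynomial.homogeneousSubmodule (Fin e) R l) := by
  classical
  let D := (Finset.univ : Finset (Fin e)).finsuppAntidiag l
  have hD : ∀ m : Fin e →₀ ℕ, m ∈ D ↔ m.degree = l := by
    intro m
    rw [Finset.mem_finsuppAntidiag, Finsupp.degree_eq_sum]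
    simp
  let φ : (D → R) →ₗ[R] MvPolynomial (Fin e) R :=
    ∑ m : D, (MvPolynomial.monomial m.1) ∘ₗ LinearMap.proj m
  have hφ : ∀ (f : D → R) (m : D), MvPolynomial.coeff m.1 (φ f) = f m := by
    intro f m
    simp only [φ, LinearMap.sum_apply, LinearMap.comp_apply, LinearMap.proj_apply,
      MvPolynomial.coeff_sum, MvPolynomial.coeff_monomial]
    rw [Finset.sum_eq_single m]
    · simp
    · intro m' _ hne
      rw [if_neg fun h => hne (Subtype.ext h)]
    · simp
  have hmem : ∀ f, φ f ∈ MvPolynomial.homogeneousSubmodule (Fin e) R l := by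
    intro f
    simp only [φ, LinearMap.sum_apply, LinearMap.comp_apply, LinearMap.proj_apply]
    exact Submodule.sum_mem _ fun m _ => MvPolynomial.isHomogeneous_monomial _ ((hD m).1 m.2)
  refine ⟨LinearEquiv.ofBijective (φ.codRestrict _ hmem) ⟨?_, ?_⟩⟩
  · intro f f' h
    funext m
    have h1 : φ f = φ f' := congrArg Subtype.val h
    rw [← hφ f, h1, hφ]
  · rintro ⟨x, hx⟩
    refine ⟨fun m => MvPolynomial.coeff m.1 x, Subtype.ext ?_⟩
    change φ _ = x
    ext m
    by_cases hm : m ∈ D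
    · exact hφ _ ⟨m, hm⟩
    · have hne : m.degree ≠ l := fun h => hm ((hD m).2 h)
      rw [MvPolynomial.IsHomogeneous.coeff_eq_zero (φ := x) hx hne,
        MvPolynomial.IsHomogeneous.coeff_eq_zero (φ := φ _) (hmem _) hne]

end FormsSubstitution

/-! ### The colength of a linear substitution on forms -/

section FormsLength

open nonZeroDivisors

variable {R : Type*} [CommRing R] [Algebra ℂ R]

theorem cokerLength_lsmul_congr {X Y : Type*} [AddCommGroup X] [Module R X] [Module ℂ X]
    [IsScalarTower ℂ R X] [AddCommGroup Y] [Module R Y] [Module ℂ Y] [IsScalarTower ℂ R Y]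
    (φ : X ≃ₗ[R] Y) (c : R) :
    cokerLength (LinearMap.lsmul R X c) = cokerLength (LinearMap.lsmul R Y c) := by
  have h1 := cokerLength_comp φ.toLinearMap (LinearMap.lsmul R X c) φ.injective
  have h2 : φ.toLinearMap ∘ₗ LinearMap.lsmul R X c = LinearMap.lsmul R Y c ∘ₗ φ.toLinearMap := by
    ext x
    simp
  have h3 : LinearMap.range (LinearMap.lsmul R Y c ∘ₗ φ.toLinearMap) =
      LinearMap.range (LinearMap.lsmul R Y c) :=
    LinearMap.range_comp_of_range_eq_top _ φ.range
  rw [h2, cokerLength_eq_zero φ.surjective, zero_add] at h1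
  rw [← h1, cokerLength, cokerLength, h3]

theorem cokerLength_lsmul_one : cokerLength (LinearMap.lsmul R R 1) = 0 :=
  cokerLength_eq_zero fun x => ⟨x, one_smul R x⟩

theorem cokerLength_lsmul_homogeneousSubmodule (e l : ℕ) (c : R) :
    cokerLength (LinearMap.lsmul R (MvPolynomial.homogeneousSubmodule (Fin e) R l) c) =
      (e.multichoose l : ℕ∞) * cokerLength (LinearMap.lsmul R R c) := by
  obtain ⟨φ⟩ := exists_pi_equiv_homogeneousSubmodule R e l
  rw [← cokerLength_lsmul_congr φ, cokerLength_lsmul_pi, Fintype.card_coe,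
    Finset.card_finsuppAntidiag_nat_eq_multichoose, Finset.card_univ, Fintype.card_fin]

variable {e : ℕ}

theorem cokerLength_substForms_mul (l : ℕ) (A B : Matrix (Fin e) (Fin e) R) (hA : A.det ∈ R⁰) :
    cokerLength (substForms l (A * B)) =
      cokerLength (substForms l A) + cokerLength (substForms l B) := by
  rw [substForms_mul, cokerLength_comp _ _ (substForms_injective l hA)]

theorem cokerLength_substForms_of_isUnit (l : ℕ) {A : Matrix (Fin e) (Fin e) R}
    (hA : IsUnit A.det) : cokerLength (substForms l A) = 0 :=
  cokerLength_eq_zero (substForms_surjective l hA)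

omit [Algebra ℂ R] in
theorem det_diagonal_update (i : Fin e) (a : R) :
    (Matrix.diagonal (Function.update (1 : Fin e → R) i a)).det = a := by
  rw [Matrix.det_diagonal, Finset.prod_update_of_mem (Finset.mem_univ i)]
  simp

/-- The two matrices are conjugate by the permutation matrix of a transposition, whose substitution
has zero cokernel. -/
theorem cokerLength_substForms_diagonal_update (l : ℕ) (i j : Fin e) {a : R} (ha : a ∈ R⁰) :
    cokerLength (substForms l (Matrix.diagonal (Function.update (1 : Fin e → R) i a))) =
      cokerLength (substForms l (Matrix.diagonal (Function.update (1 : Fin e → R) j a))) := by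
  let σ : Equiv.Perm (Fin e) := Equiv.swap i j
  let S : Matrix (Fin e) (Fin e) R := σ.toPEquiv.toMatrix
  have hS : IsUnit S.det := by
    simp only [S, Matrix.det_permutation]
    exact (Units.isUnit _).map (Int.castRingHom R)
  have hSR : S.det ∈ R⁰ := hS.mem_nonZeroDivisors
  have h : Matrix.diagonal (Function.update (1 : Fin e → R) i a) * S =
      S * Matrix.diagonal (Function.update (1 : Fin e → R) j a) := by
    ext k m
    rw [Matrix.diagonal_mul, Matrix.mul_diagonal]
    simp only [S, PEquiv.toMatrix_apply, Equiv.toPEquiv_apply, Option.mem_def, Option.some.injEq]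
    by_cases hk : σ k = m
    · subst hk
      have : Function.update (1 : Fin e → R) j a (σ k) = Function.update (1 : Fin e → R) i a k := by
        simp only [Function.update_apply]
        congr 1
        simp only [σ, eq_iff_iff]
        rw [← Equiv.eq_symm_apply]
        simp
      simp [this]
    · simp [hk]
  have h1 := congrArg (fun A => cokerLength (substForms l A)) h
  rw [cokerLength_substForms_mul l _ _ (by rwa [det_diagonal_update]),
    cokerLength_substForms_mul l _ _ hSR, cokerLength_substForms_of_isUnit l hS, add_zero,
    zero_add] at h1
  exact h1

theorem cokerLength_substForms_diagonal (l : ℕ) (i : Fin e) {a : R} (ha : a ∈ R⁰)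
    (s : Finset (Fin e)) :
    cokerLength (substForms l (Matrix.diagonal fun k => if k ∈ s then a else 1)) =
      (s.card : ℕ∞) *
        cokerLength (substForms l (Matrix.diagonal (Function.update (1 : Fin e → R) i a))) := by
  induction s using Finset.induction_on with
  | empty =>
    have : (fun k : Fin e => if k ∈ (∅ : Finset (Fin e)) then a else 1) = fun _ => 1 := by simp
    rw [this, Matrix.diagonal_one, cokerLength_substForms_of_isUnit l (by simp)]
    simp
  | insert j s hj ih =>
    have : (Matrix.diagonal fun k => if k ∈ insert j s then a else 1) =
        Matrix.diagonal (Function.update (1 : Fin e → R) j a) *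
          Matrix.diagonal fun k => if k ∈ s then a else 1 := by
      rw [Matrix.diagonal_mul_diagonal]
      congr 1
      funext k
      by_cases hk : k = j
      · subst hk; simp [hj]
      · simp [hk]
    rw [this, cokerLength_substForms_mul l _ _ (by rwa [det_diagonal_update]), ih,
      cokerLength_substForms_diagonal_update l j i ha, Finset.card_insert_of_notMem hj]
    push_cast
    ring

variable [IsCurveRing R]

/-- The length of `Sym^l` of the cokernel of a square matrix. -/
theorem card_mul_cokerLength_substForms (l : ℕ) {A : Matrix (Fin e) (Fin e) R}
    (hA : A.det ∈ R⁰) :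
    (e : ℕ∞) * cokerLength (substForms l A) =
      (e.multichoose l * l : ℕ) * cokerLength (LinearMap.lsmul R R A.det) := by
  rcases Nat.eq_zero_or_pos e with rfl | he
  · rw [Matrix.det_fin_zero, cokerLength_lsmul_one]
    simp
  let i₀ : Fin e := ⟨0, he⟩
  let ω : R → ℕ∞ := fun a => (e.multichoose l * l : ℕ) * cokerLength (LinearMap.lsmul R R a)
  refine eq_comp_det_of_diagonal (ω := ω) ?_ ?_ ?_ e
    (fun A => (e : ℕ∞) * cokerLength (substForms l A)) ?_ ?_ ?_ A hA
  · simp only [ω]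
    rw [cokerLength_lsmul_one, mul_zero]
  · intro a ha b hb
    simp only [ω]
    rw [cokerLength_lsmul_mul ha, mul_add]
  · intro a ha
    exact WithTop.mul_ne_top (ENat.natCast_ne_top _) (cokerLength_lsmul_ne_top ha)
  · intro A B hA hB
    rw [cokerLength_substForms_mul l _ _ hA, mul_add]
  · intro A hA
    rw [cokerLength_substForms_of_isUnit l hA, mul_zero]
  · intro i a ha
    -- The scalar matrix `a • 1` is a product of `e` elementary diagonal matrices with equal
    -- cokernel lengths, and it acts as `a ^ l` on a free module of rank `e.multichoose l`.
    -- Comparing only determines `e` times one length, whence the factor `e` in the formula.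
    have h1 := cokerLength_substForms_diagonal l i ha Finset.univ
    have h2 : (Matrix.diagonal fun k : Fin e => if k ∈ Finset.univ then a else 1) =
        a • (1 : Matrix (Fin e) (Fin e) R) := by
      simp [Matrix.smul_one_eq_diagonal]
    rw [h2, substForms_smul_one, cokerLength_lsmul_homogeneousSubmodule, cokerLength_lsmul_pow ha,
      Finset.card_univ, Fintype.card_fin] at h1
    simp only [ω]
    rw [← h1]
    push_cast
    ring

end FormsLength

/-! ### Growth of the number of monomials -/

section MultichooseAsymptotics

/-- Each new factor `l + 1 + m` adds only terms of lower order to `l` times it. The extra factor `l`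
on both sides avoids the exponent `m - 1`. -/
theorem exists_mul_ascFactorial_le (m : ℕ) :
    ∃ C : ℕ, ∀ l, 1 ≤ l → l * (l + 1).ascFactorial m ≤ l * l ^ m + C * l ^ m := by
  induction m with
  | zero => exact ⟨0, fun l _ => by simp⟩
  | succ m ih =>
    obtain ⟨C, hC⟩ := ih
    refine ⟨(m + 1) + C + C * (m + 1), fun l hl => ?_⟩
    rw [Nat.ascFactorial_succ]
    calc l * ((l + 1 + m) * (l + 1).ascFactorial m)
        = (l * (l + 1).ascFactorial m) * (l + 1 + m) := by ring
      _ ≤ (l * l ^ m + C * l ^ m) * (l + 1 + m) := Nat.mul_le_mul_right _ (hC l hl)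
      _ = l * l ^ (m + 1) + ((m + 1) + C) * l ^ (m + 1) + (C * (m + 1) * l ^ m) * 1 := by ring
      _ ≤ l * l ^ (m + 1) + ((m + 1) + C) * l ^ (m + 1) + (C * (m + 1) * l ^ m) * l := by gcongr
      _ = _ := by ring

theorem factorial_mul_multichoose_succ (m l : ℕ) :
    m.factorial * (m + 1).multichoose l = (l + 1).ascFactorial m := by
  rw [Nat.ascFactorial_eq_factorial_mul_choose, Nat.multichoose_eq]
  congr 1
  have h : m + 1 + l - 1 = m + l := by omega
  rw [h, add_comm l m, Nat.choose_symm_add]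

/-- With `m = e - 1`, the number of monomials is `(l + 1) ⋯ (l + m) / m!`, so dividing the identity
by `e` gives the main term `k l^e / e!`; `E` is of order `l^(e-1)`. The case `e = 1` serves the
Hilbert–Samuel multiplicity. -/
theorem isBigO_of_mul_add_eq_multichoose {e k K : ℕ} (he : 0 < e) {D E : ℕ → ℕ}
    (h : ∀ l, e * (D l + E l) = e.multichoose l * l * k) (hE : ∀ l, E l ≤ e.multichoose l * K) :
    (fun l : ℕ => (D l : ℝ) - k * (l : ℝ) ^ e / e.factorial) =O[atTop]
      fun l : ℕ => (l : ℝ) ^ ((e : ℤ) - 1) := by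
  obtain ⟨m, rfl⟩ : ∃ m, e = m + 1 := ⟨e - 1, by omega⟩
  obtain ⟨C, hC⟩ := exists_mul_ascFactorial_le m
  refine IsBigO.of_bound (k * C + K * (1 + C) : ℕ) ?_
  filter_upwards [eventually_ge_atTop 1] with l hl
  have hpow : (l : ℝ) ^ (((m + 1 : ℕ) : ℤ) - 1) = (l : ℝ) ^ m := by
    rw [Nat.cast_succ, add_sub_cancel_right, zpow_natCast]
  rw [hpow, Real.norm_eq_abs, Real.norm_of_nonneg (by positivity : (0 : ℝ) ≤ (l : ℝ) ^ m)]
  set P := (l + 1).ascFactorial m with hP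
  have hPl : (l : ℝ) * l ^ m ≤ l * P := by
    have : l ^ m ≤ P := (Nat.pow_le_pow_left (Nat.le_succ l) m).trans (Nat.pow_succ_le_ascFactorial _ _)
    exact_mod_cast Nat.mul_le_mul_left l this
  have hPu : (l : ℝ) * P ≤ l * l ^ m + C * l ^ m := by exact_mod_cast hC l hl
  have hl0 : (1 : ℝ) ≤ l := by exact_mod_cast hl
  have hlm : (0 : ℝ) ≤ (l : ℝ) ^ m := by positivity
  have hPu' : (P : ℝ) ≤ (1 + C) * l ^ m := by
    have h1 : (C : ℝ) * l ^ m ≤ l * (C * l ^ m) :=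
      le_mul_of_one_le_left (by positivity) hl0
    have h2 : (l : ℝ) * P ≤ l * ((1 + C) * l ^ m) := by nlinarith
    exact le_of_mul_le_mul_left h2 (by linarith)
  have hm1 : (1 : ℝ) ≤ m.factorial := by exact_mod_cast m.factorial_pos
  have hN : (m.factorial : ℝ) * (m + 1).multichoose l = P := by
    exact_mod_cast factorial_mul_multichoose_succ m l
  have hEP : (E l : ℝ) ≤ K * ((1 + C) * l ^ m) := by
    have h1 : (E l : ℝ) ≤ (m + 1).multichoose l * K := by exact_mod_cast hE l
    have h2 : ((m + 1).multichoose l : ℝ) ≤ P := by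
      rw [← hN]
      exact le_mul_of_one_le_left (by positivity) hm1
    calc (E l : ℝ) ≤ (m + 1).multichoose l * K := h1
      _ ≤ P * K := by gcongr
      _ ≤ ((1 + C) * l ^ m) * K := by gcongr
      _ = _ := by ring
  have hf1 : (1 : ℝ) ≤ (m + 1).factorial := by exact_mod_cast (m + 1).factorial_pos
  have hD : (D l : ℝ) - k * (l : ℝ) ^ (m + 1) / (m + 1).factorial =
      k * (l * P - l * l ^ m) / (m + 1).factorial - E l := by
    have h1 : ((m : ℝ) + 1) * (D l + E l) = (m + 1).multichoose l * l * k := by exact_mod_cast h l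
    have h2 : ((m + 1).factorial : ℝ) * (D l + E l) = P * l * k := by
      rw [Nat.factorial_succ, ← hN]
      push_cast
      linear_combination (m.factorial : ℝ) * h1
    field_simp
    linear_combination h2
  have hT0 : 0 ≤ k * (l * P - l * (l : ℝ) ^ m) / (m + 1).factorial :=
    div_nonneg (mul_nonneg (Nat.cast_nonneg k) (by linarith)) (by linarith)
  have hT1 : k * (l * P - l * (l : ℝ) ^ m) / (m + 1).factorial ≤ k * (C * l ^ m) := by
    refine (div_le_self (mul_nonneg (Nat.cast_nonneg k) (by linarith)) hf1).trans ?_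
    exact mul_le_mul_of_nonneg_left (by linarith) (Nat.cast_nonneg k)
  rw [hD]
  push_cast
  have hE0 : (0 : ℝ) ≤ E l := Nat.cast_nonneg _
  have hX : 0 ≤ (k : ℝ) * (C * l ^ m) := by positivity
  have hY : 0 ≤ (K : ℝ) * ((1 + C) * l ^ m) := by positivity
  have hsum : ((k : ℝ) * C + K * (1 + C)) * l ^ m = k * (C * l ^ m) + K * ((1 + C) * l ^ m) := by
    ring
  rw [hsum, abs_le]
  constructor <;> linarith

end MultichooseAsymptotics

/-! ### Cramer's rule and reductions of modules -/

section Cramer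

variable {R : Type*} [CommRing R] {e : ℕ}

theorem det_mem_minorsIdeal {N : Submodule R (Fin e → R)} {Φ : Matrix (Fin e) (Fin e) R}
    (hΦ : ∀ j, Φ.col j ∈ N) : Φ.det ∈ minorsIdeal N e :=
  Ideal.subset_span ⟨fun j => ⟨Φ.col j, hΦ j⟩, id, rfl⟩

/-- A numerator in Cramer's rule is the determinant of `Φ` with one column replaced by `v`, again a
matrix with columns in `N`. -/
theorem cramer_mem_minorsIdeal {N : Submodule R (Fin e → R)} {Φ : Matrix (Fin e) (Fin e) R}
    (hΦ : ∀ j, Φ.col j ∈ N) {v : Fin e → R} (hv : v ∈ N) (i : Fin e) :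
    Φ.cramer v i ∈ minorsIdeal N e := by
  rw [Matrix.cramer_apply]
  refine det_mem_minorsIdeal fun j => ?_
  by_cases h : j = i
  · subst h
    convert hv using 1
    ext k
    simp [Matrix.col]
  · convert hΦ j using 1
    ext k
    simp [Matrix.col, h]

theorem minorsIdeal_map_mulVecLin_le {p : ℕ} (A : Matrix (Fin e) (Fin p) R)
    (M : Submodule R (Fin p → R)) : minorsIdeal (M.map A.mulVecLin) e ≤ minorsIdeal M e := by
  refine Ideal.span_le.2 ?_
  rintro x ⟨v, r, rfl⟩
  choose w hwM hw using fun j => (v j).2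
  have h1 : (Matrix.of fun i j => (v j : Fin e → R) (r i)) =
      A.submatrix r id * Matrix.of fun k j => w j k := by
    ext i j
    rw [Matrix.of_apply, ← hw j]
    simp [Matrix.mul_apply, Matrix.mulVec, dotProduct]
  rw [h1, det_mul_eq_sum_rows]
  exact Ideal.sum_mem _ fun I _ => Ideal.mul_mem_left _ _
    (Ideal.subset_span ⟨fun j => ⟨w j, hwM j⟩, I, rfl⟩)

theorem smul_mul_smul_le {S : Type*} [CommRing S] [Algebra R S] (J J' : Ideal R)
    (N N' : Submodule R S) : (J • N) * (J' • N') ≤ (J * J') • (N * N') := by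
  refine Submodule.mul_le.2 fun x hx y hy => ?_
  induction hx using Submodule.smul_induction_on' with
  | smul a ha n hn =>
    induction hy using Submodule.smul_induction_on' with
    | smul b hb n' hn' =>
      rw [smul_mul_smul_comm]
      exact Submodule.smul_mem_smul (Ideal.mul_mem_mul ha hb) (Submodule.mul_mem_mul hn hn')
    | add y _ y' _ h h' => rw [mul_add]; exact Submodule.add_mem _ h h'
  | add x _ x' _ h h' => rw [add_mul]; exact Submodule.add_mem _ h h'

/-- Cramer's rule for products of linear forms. -/
theorem det_pow_smul_mem {N : Submodule R (Fin e → R)} {Φ : Matrix (Fin e) (Fin e) R}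
    (hΦ : ∀ j, Φ.col j ∈ N) (l : ℕ) {x : MvPolynomial (Fin e) R} (hx : x ∈ formsOf N l) :
    Φ.det ^ l • x ∈ minorsIdeal N e ^ l • formsOf (LinearMap.range Φ.mulVecLin) l := by
  induction l generalizing x with
  | zero => simpa [formsOf] using hx
  | succ l ih =>
    rw [formsOf, pow_succ] at hx
    induction hx using Submodule.mul_induction_on' with
    | mem_mul_mem a ha b hb =>
      obtain ⟨v, hv, rfl⟩ := hb
      rw [pow_succ Φ.det, ← smul_mul_smul_comm, formsOf, pow_succ (minorsIdeal N e),
        pow_succ (Submodule.map _ _)]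
      refine smul_mul_smul_le _ _ _ _ (Submodule.mul_mem_mul (ih ha) ?_)
      -- Cramer's rule without division: `det Φ · v` is the combination of the columns of `Φ` with
      -- the numerators as coefficients.
      have h1 : Φ.det • v = ∑ j, Φ.cramer v j • Φ.mulVec (Pi.single j 1) := by
        rw [← Matrix.mulVec_cramer]
        ext i
        simp [Matrix.mulVec, dotProduct, mul_comm, Matrix.col]
      rw [← map_smul, h1, map_sum]
      refine Submodule.sum_mem _ fun j _ => ?_
      rw [map_smul]
      exact Submodule.smul_mem_smul (cramer_mem_minorsIdeal hΦ hv j)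
        ⟨_, ⟨Pi.single j 1, rfl⟩, rfl⟩
    | add x _ y _ h h' => rw [smul_add]; exact Submodule.add_mem _ h h'

open nonZeroDivisors in
-- Cramer's rule puts `det Φ ^ l • x` into the forms of the image with coefficients in the `l`-th
-- power of the ideal of minors. Multiplied by `c`, these coefficients become divisible by `det Φ ^
-- l`, which then cancels from both sides. Thus a reduction of the ideal of minors yields one of the
-- module.
theorem smul_mem_formsOf_range {N : Submodule R (Fin e → R)} {Φ : Matrix (Fin e) (Fin e) R}
    (hΦ : ∀ j, Φ.col j ∈ N) (hdet : Φ.det ∈ R⁰) {l : ℕ} {c : R}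
    (hc : ∀ x ∈ minorsIdeal N e ^ l, Φ.det ^ l ∣ c * x) {x : MvPolynomial (Fin e) R}
    (hx : x ∈ formsOf N l) : c • x ∈ formsOf (LinearMap.range Φ.mulVecLin) l := by
  have h1 : ∀ y ∈ minorsIdeal N e ^ l • formsOf (LinearMap.range Φ.mulVecLin) l,
      ∃ z ∈ formsOf (LinearMap.range Φ.mulVecLin) l, c • y = Φ.det ^ l • z := by
    intro y hy
    induction hy using Submodule.smul_induction_on' with
    | smul a ha n hn =>
      obtain ⟨t, ht⟩ := hc a ha
      exact ⟨t • n, Submodule.smul_mem _ _ hn, by rw [smul_smul, ht, smul_smul]⟩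
    | add y _ y' _ h h' =>
      obtain ⟨z, hz, h⟩ := h
      obtain ⟨z', hz', h'⟩ := h'
      exact ⟨z + z', Submodule.add_mem _ hz hz', by rw [smul_add, smul_add, h, h']⟩
  obtain ⟨z, hz, h2⟩ := h1 _ (det_pow_smul_mem hΦ l hx)
  have h3 : c • x = z := mvPolynomial_smul_injective (pow_mem hdet l) (by
    rw [LinearMap.lsmul_apply, LinearMap.lsmul_apply, ← h2, smul_comm])
  rwa [h3]

end Cramer

/-! ### Multiplicities computed from a reduction -/

section Multiplicity

open nonZeroDivisors

variable {R : Type*} [CommRing R]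

theorem exists_subquotient_equiv {V W : Type*} [AddCommGroup V] [Module R V] [AddCommGroup W]
    [Module R W] (φ : V ≃ₗ[R] W) {A B : Submodule R V} {A' B' : Submodule R W}
    (hA : A.map φ.toLinearMap = A') (hB : B.map φ.toLinearMap = B') :
    Nonempty ((B ⧸ A.submoduleOf B) ≃ₗ[R] B' ⧸ A'.submoduleOf B') := by
  subst hA hB
  refine ⟨Submodule.Quotient.equiv _ _ (φ.submoduleMap B) ?_⟩
  ext ⟨y, x, hx, rfl⟩
  constructor
  · rintro ⟨⟨z, hz⟩, hzA, hzx⟩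
    have h1 : φ z = φ x := congrArg Subtype.val hzx
    exact ⟨z, hzA, h1⟩
  · rintro ⟨z, hz, hzx⟩
    have h1 : z = x := φ.injective hzx
    subst h1
    exact ⟨⟨z, hx⟩, hz, rfl⟩

theorem map_equivMvPolynomial_reesComponent {e : ℕ} (N : Submodule R (Fin e → R)) (l : ℕ) :
    (reesComponent N l).map
      (SymmetricAlgebra.equivMvPolynomial (Pi.basisFun R (Fin e))).toLinearEquiv.toLinearMap =
        formsOf N l := by
  have h : (SymmetricAlgebra.equivMvPolynomial (Pi.basisFun R (Fin e))).toLinearMap ∘ₗ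
      SymmetricAlgebra.ι R (Fin e → R) = linearForm := by
    refine (Pi.basisFun R (Fin e)).ext fun j => ?_
    simpa [linearForm] using
      SymmetricAlgebra.equivMvPolynomial_ι_apply (Pi.basisFun R (Fin e)) j
  have h1 : (reesComponent N l).map
      (SymmetricAlgebra.equivMvPolynomial (Pi.basisFun R (Fin e))).toAlgHom.toLinearMap =
        formsOf N l := by
    rw [reesComponent, Submodule.map_pow, ← Submodule.map_comp]
    exact congrArg (fun f => (N.map f) ^ l) h
  exact h1

theorem exists_reesQuotient_equiv {e : ℕ} (N : Submodule R (Fin e → R)) (l : ℕ) :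
    Nonempty (ReesQuotient N l ≃ₗ[R] (MvPolynomial.homogeneousSubmodule (Fin e) R l ⧸
      (formsOf N l).submoduleOf (MvPolynomial.homogeneousSubmodule (Fin e) R l))) :=
  exists_subquotient_equiv _ (map_equivMvPolynomial_reesComponent N l)
    ((map_equivMvPolynomial_reesComponent ⊤ l).trans (formsOf_top l))

variable [Algebra ℂ R]

theorem length_reesQuotient {e : ℕ} (N : Submodule R (Fin e → R)) (l : ℕ) :
    Module.length ℂ (ReesQuotient N l) =
      Module.length ℂ (MvPolynomial.homogeneousSubmodule (Fin e) R l ⧸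
        (formsOf N l).submoduleOf (MvPolynomial.homogeneousSubmodule (Fin e) R l)) := by
  obtain ⟨φ⟩ := exists_reesQuotient_equiv N l
  exact (φ.restrictScalars ℂ).length_eq

theorem exists_length_quotient_eq_add {X Y : Type*} [AddCommGroup X] [Module R X] [Module ℂ X]
    [IsScalarTower ℂ R X] [AddCommGroup Y] [Module R Y] [Module ℂ Y] [IsScalarTower ℂ R Y]
    {A B : Submodule R Y} (hAB : A ≤ B) {c : R} (hc : Function.Injective (LinearMap.lsmul R Y c))
    (f : X →ₗ[R] Y) (hA : A = LinearMap.range f) (hB : ∀ b ∈ B, c • b ∈ A) :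
    ∃ E : ℕ∞, Module.length ℂ (Y ⧸ A) = E + Module.length ℂ (Y ⧸ B) ∧
      E ≤ cokerLength (LinearMap.lsmul R X c) :=
  ⟨_, length_quotient_eq_add hAB, length_subquotient_le hc f hA hB⟩

theorem finite_of_length_ne_top {V : Type*} [AddCommGroup V] [Module ℂ V]
    (h : Module.length ℂ V ≠ ⊤) : Module.Finite ℂ V := by
  have := (isFiniteLength_iff_isNoetherian_isArtinian.1 (Module.length_ne_top_iff.1 h)).1
  infer_instance

theorem length_eq_finrank {V : Type*} [AddCommGroup V] [Module ℂ V] [Module.Finite ℂ V] :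
    Module.length ℂ V = Module.finrank ℂ V :=
  Module.length_eq_finrank ℂ V

/-- Comparing the Rees components of a module with those of the module generated by the columns of
a square matrix. -/
theorem exists_length_reesQuotient_add {e : ℕ} {N : Submodule R (Fin e → R)}
    {Φ : Matrix (Fin e) (Fin e) R} (hΦ : ∀ j, Φ.col j ∈ N) (hdet : Φ.det ∈ R⁰) {l : ℕ} {c : R}
    (hcR : c ∈ R⁰) (hc : ∀ x ∈ minorsIdeal N e ^ l, Φ.det ^ l ∣ c * x) :
    ∃ E : ℕ∞, cokerLength (substForms l Φ) = E + Module.length ℂ (ReesQuotient N l) ∧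
      E ≤ e.multichoose l * cokerLength (LinearMap.lsmul R R c) := by
  let H := MvPolynomial.homogeneousSubmodule (Fin e) R l
  let A : Submodule R H := LinearMap.range (substForms l Φ)
  let B : Submodule R H := (formsOf N l).submoduleOf H
  have hA : ∀ x : H, x ∈ A ↔ (x : MvPolynomial (Fin e) R) ∈ formsOf (LinearMap.range Φ.mulVecLin) l := by
    intro x
    rw [← map_range_substForms]
    constructor
    · exact fun hx => ⟨x, hx, rfl⟩
    · rintro ⟨y, hy, hyx⟩
      rwa [← Subtype.ext (a1 := y) (a2 := x) hyx]
  have hrange : LinearMap.range Φ.mulVecLin ≤ N := by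
    rw [Matrix.range_mulVecLin]
    exact Submodule.span_le.2 (by rintro _ ⟨j, rfl⟩; exact hΦ j)
  have hAB : A ≤ B := fun x hx => formsOf_mono hrange l ((hA x).1 hx)
  rw [length_reesQuotient, ← cokerLength_lsmul_homogeneousSubmodule]
  exact exists_length_quotient_eq_add (A := A) (B := B) hAB (homogeneous_smul_injective hcR l)
    (substForms l Φ) rfl fun b hb => (hA _).2 (smul_mem_formsOf_range hΦ hdet hc hb)

variable [IsCurveRing R]

/-- The Buchsbaum–Rim multiplicity of a module with a reduction generated by the columns of a square
matrix. -/
theorem isBuchsbaumRimMultiplicity_of_reduction {e : ℕ} {N : Submodule R (Fin e → R)}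
    {Φ : Matrix (Fin e) (Fin e) R} (hΦ : ∀ j, Φ.col j ∈ N) (hdet : Φ.det ∈ R⁰) {c : R}
    (hcR : c ∈ R⁰) (hc : ∀ l, ∀ x ∈ minorsIdeal N e ^ l, Φ.det ^ l ∣ c * x) {k : ℕ}
    (hk : cokerLength (LinearMap.lsmul R R Φ.det) = k) : IsBuchsbaumRimMultiplicity N k := by
  obtain ⟨K, hK⟩ := ENat.ne_top_iff_exists.1 (cokerLength_lsmul_ne_top hcR)
  choose E hE1 hE2 using fun l => exists_length_reesQuotient_add hΦ hdet hcR (hc l)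
  have hcard := fun l => card_mul_cokerLength_substForms l hdet
  rw [hk] at hcard
  -- The length formula carries the factor `e` and is void for `e = 0`; there the determinant is
  -- `1`, `k = 0`, and all quotients vanish.
  rcases Nat.eq_zero_or_pos e with rfl | he
  · have hk0 : k = 0 := by
      rw [Matrix.det_fin_zero, cokerLength_lsmul_one] at hk
      exact_mod_cast hk.symm
    have h0 : ∀ l, Module.length ℂ (ReesQuotient N l) = 0 := by
      intro l
      have := hE1 l
      rw [cokerLength_substForms_of_isUnit l (by simp)] at this
      exact (add_eq_zero.1 this.symm).2
    have hfin : ∀ l, Module.Finite ℂ (ReesQuotient N l) := fun l =>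
      finite_of_length_ne_top (by rw [h0]; exact ENat.zero_ne_top)
    refine ⟨hfin, ?_⟩
    have h1 : ∀ l, Module.finrank ℂ (ReesQuotient N l) = 0 := by
      intro l
      have := hfin l
      have h2 := h0 l
      rw [length_eq_finrank] at h2
      exact_mod_cast h2
    simp only [h1, hk0]
    simpa using isBigO_zero _ _
  · have hfinμ : ∀ l, cokerLength (substForms l Φ) ≠ ⊤ := by
      intro l htop
      have h1 := hcard l
      rw [htop, ENat.mul_top (by exact_mod_cast he.ne')] at h1
      exact absurd h1.symm (by exact_mod_cast ENat.natCast_ne_top _)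
    have hfin : ∀ l, Module.Finite ℂ (ReesQuotient N l) := fun l =>
      finite_of_length_ne_top fun h => hfinμ l (by rw [hE1, h, add_top])
    refine ⟨hfin, ?_⟩
    have hEfin : ∀ l, E l ≠ ⊤ := fun l h => hfinμ l (by rw [hE1, h, top_add])
    choose E' hE' using fun l => ENat.ne_top_iff_exists.1 (hEfin l)
    refine isBigO_of_mul_add_eq_multichoose (E := E') (K := K) he (fun l => ?_) fun l => ?_
    · have h1 := hcard l
      have := hfin l
      rw [hE1, length_eq_finrank, ← hE'] at h1
      rw [add_comm]
      exact_mod_cast h1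
    · have h1 := hE2 l
      rw [← hE', ← hK] at h1
      exact_mod_cast h1

/-- The Hilbert–Samuel multiplicity of an ideal with a principal reduction. -/
theorem isHilbertSamuelMultiplicity_of_reduction {J : Ideal R} {d c : R} (hdJ : d ∈ J)
    (hd : d ∈ R⁰) (hcR : c ∈ R⁰) (hc : ∀ l, ∀ x ∈ J ^ l, d ^ l ∣ c * x) {k : ℕ}
    (hk : cokerLength (LinearMap.lsmul R R d) = k) : IsHilbertSamuelMultiplicity 1 J k := by
  obtain ⟨K, hK⟩ := ENat.ne_top_iff_exists.1 (cokerLength_lsmul_ne_top hcR)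
  have hle : ∀ l, Ideal.span {d ^ l} ≤ J ^ l := fun l =>
    (Ideal.span_singleton_le_iff_mem _).2 (Ideal.pow_mem_pow hdJ l)
  -- From `c Jˡ ⊆ (dˡ) ⊆ Jˡ`: the length of `R / (dˡ)` is `l k` and exceeds that of `R / Jˡ` by at
  -- most the length of `R / (c)`.
  have h1 : ∀ l : ℕ, ∃ E : ℕ∞, ((l : ℕ) : ℕ∞) * k = E + Module.length ℂ (R ⧸ J ^ l) ∧ E ≤ K := by
    intro l
    rw [hK, ← hk, ← cokerLength_lsmul_pow hd, cokerLength, range_lsmul_self]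
    exact exists_length_quotient_eq_add (hle l) (lsmul_injective hcR) (LinearMap.lsmul R R (d ^ l))
      (range_lsmul_self _).symm fun b hb => Ideal.mem_span_singleton.2 (hc l b hb)
  choose E hE1 hE2 using h1
  have hfin : ∀ l, Module.Finite ℂ (R ⧸ J ^ l) := fun l =>
    finite_of_length_ne_top fun h => by
      have := hE1 l
      rw [h, add_top] at this
      exact absurd this (by exact_mod_cast ENat.natCast_ne_top _)
  refine ⟨hfin, ?_⟩
  have hEfin : ∀ l, E l ≠ ⊤ := fun l h => by
    have := hE2 l
    rw [h] at this
    exact absurd (top_le_iff.1 this) (ENat.natCast_ne_top _)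
  choose E' hE' using fun l => ENat.ne_top_iff_exists.1 (hEfin l)
  refine isBigO_of_mul_add_eq_multichoose (E := E') (K := K) one_pos (fun l => ?_) fun l => ?_
  · have h2 := hE1 l
    have := hfin l
    rw [length_eq_finrank, ← hE'] at h2
    have h3 : l * k = E' l + Module.finrank ℂ (R ⧸ J ^ l) := by exact_mod_cast h2
    rw [Nat.multichoose_one, one_mul, one_mul, h3, add_comm]
  · have h2 := hE2 l
    rw [← hE'] at h2
    rw [Nat.multichoose_one, one_mul]
    exact_mod_cast h2

end Multiplicity

/-! ### Generic rank and minors -/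

section GenericRank

open nonZeroDivisors

theorem exists_submatrix_det_ne_zero {K : Type*} [Field K] {p e : ℕ} {W : Matrix (Fin p) (Fin e) K}
    (hW : LinearIndependent K W.col) : ∃ r : Fin e → Fin p, (W.submatrix r id).det ≠ 0 := by
  obtain ⟨g, hg⟩ := LinearMap.exists_leftInverse_of_injective W.mulVecLin
    (LinearMap.ker_eq_bot.2 (Matrix.mulVec_injective_iff.2 hW))
  have h1 : LinearMap.toMatrix' g * W = 1 := by
    rw [← LinearMap.toMatrix'_id, ← hg, LinearMap.toMatrix'_comp,
      ← Matrix.toLin'_apply', LinearMap.toMatrix'_toLin']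
  by_contra! hcon
  have h2 := congrArg Matrix.det h1
  rw [det_mul_eq_sum_rows, Matrix.det_one, Finset.sum_eq_zero fun r _ => by rw [hcon r, mul_zero]]
    at h2
  exact zero_ne_one h2

variable {R : Type*} [CommRing R]

/-- By minimality every prime of the localization contracts to `P`, so the maximal ideal consists of
nilpotent elements, and these vanish. -/
theorem isField_localization_of_mem_minimalPrimes [IsReduced R] {P : Ideal R} [P.IsPrime]
    (hP : P ∈ minimalPrimes R) : IsField (Localization.AtPrime P) := by
  refine IsLocalRing.isField_iff_maximalIdeal_eq.2 ((eq_bot_iff).2 fun x hx => ?_)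
  have h1 : x ∈ nilradical (Localization.AtPrime P) := by
    rw [nilradical_eq_sInf, Ideal.mem_sInf]
    intro Q hQ
    have hQ' : Q.IsPrime := hQ
    have h2 : Q.comap (algebraMap R _) ≤ P := by
      have := IsLocalRing.le_maximalIdeal hQ'.ne_top
      have h3 := Ideal.comap_mono (f := algebraMap R (Localization.AtPrime P)) this
      exact h3.trans (Localization.AtPrime.under_maximalIdeal (I := P)).le
    have h4 : P ≤ Q.comap (algebraMap R _) := hP.2 ⟨inferInstance, bot_le⟩ h2
    rw [← Localization.AtPrime.map_eq_maximalIdeal] at hx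
    exact Ideal.map_le_iff_le_comap.2 h4 hx
  have : IsReduced (Localization.AtPrime P) := 
    isReduced_localizationPreserves P.primeCompl _ inferInstance
  exact (mem_nilradical.1 h1).eq_zero

/-- The embedding of the localization of a submodule of `R^p` into the localization of `R^p`. -/
theorem exists_localizedModule_embedding {p : ℕ} (S : Submonoid R) (N : Submodule R (Fin p → R)) :
    ∃ j : LocalizedModule S N →ₗ[Localization S] (Fin p → Localization S), Function.Injective j ∧
      ∀ m : N, j (LocalizedModule.mkLinearMap S N m) = fun i => algebraMap R _ (m.1 i) := by
  let g : (Fin p → R) →ₗ[R] (Fin p → Localization S) :=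
    LinearMap.pi fun i => Algebra.linearMap R (Localization S) ∘ₗ LinearMap.proj i
  refine ⟨IsLocalizedModule.mapExtendScalars S (LocalizedModule.mkLinearMap S N) g
    (Localization S) N.subtype, ?_, fun m => ?_⟩
  · exact IsLocalizedModule.map_injective S (LocalizedModule.mkLinearMap S N) g N.subtype
      N.injective_subtype
  · exact IsLocalizedModule.map_apply S (LocalizedModule.mkLinearMap S N) g N.subtype m

/-- The localized module embeds in `K ^ p`, where `e` independent vectors have a nonzero `e × e`
minor. Clearing denominators replaces them by elements of `M` and changes the minor by a unit of
`K`. -/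
theorem HasGenericRank.exists_minor_notMem [IsReduced R] {p e : ℕ} {M : Submodule R (Fin p → R)}
    (hM : HasGenericRank R M e) {P : Ideal R} (hP : P ∈ minimalPrimes R) :
    e ≤ p ∧ ∃ x ∈ minorsIdeal M e, x ∉ P := by
  have hprime : P.IsPrime := hP.1.1
  let K := Localization P.primeCompl
  let : Field K := (isField_localization_of_mem_minimalPrimes hP).toField
  obtain ⟨j, hj, hjm⟩ := exists_localizedModule_embedding P.primeCompl M
  obtain ⟨v, hv⟩ := Module.le_rank_iff.1 (hM P hP).ge
  have hw : LinearIndependent K fun i => j (v i) := hv.map' j (LinearMap.ker_eq_bot.2 hj)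
  refine ⟨by
    have := hw.fintype_card_le_finrank
    rw [Fintype.card_fin] at this
    exact this.trans (Module.finrank_fin_fun K).le, ?_⟩
  have hms : ∀ i, ∃ (m : M) (s : P.primeCompl), s • v i = LocalizedModule.mkLinearMap _ M m := by
    intro i
    obtain ⟨⟨m, s⟩, h⟩ := IsLocalizedModule.surj P.primeCompl
      (LocalizedModule.mkLinearMap P.primeCompl M) (v i)
    exact ⟨m, s, h⟩
  choose m s hms using hms
  let W : Matrix (Fin p) (Fin e) K := Matrix.of fun k i => j (v i) k
  obtain ⟨r, hr⟩ := exists_submatrix_det_ne_zero (W := W) hw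
  refine ⟨_, Ideal.subset_span ⟨m, r, rfl⟩, fun hmem => ?_⟩
  have h1 : algebraMap R K (Matrix.det (Matrix.of fun i j => (m j : Fin p → R) (r i))) =
      (∏ i, algebraMap R K (s i)) * (W.submatrix r id).det := by
    rw [RingHom.map_det, ← Matrix.det_mul_row]
    congr 1
    ext a b
    have h2 := congrFun (hjm (m b)) (r a)
    rw [← hms b] at h2
    simp only [RingHom.mapMatrix_apply, Matrix.map_apply, Matrix.of_apply]
    rw [← h2, Submonoid.smul_def, ← algebraMap_smul K (s b : R) (v b), map_smul]
    rfl
  have h2 : algebraMap R K (Matrix.det (Matrix.of fun i j => (m j : Fin p → R) (r i))) = 0 := by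
    have h3 : algebraMap R K _ ∈ IsLocalRing.maximalIdeal (Localization.AtPrime P) :=
      (IsLocalization.AtPrime.to_map_mem_maximal_iff (Localization.AtPrime P) P _).2 hmem
    rwa [IsLocalRing.isField_iff_maximalIdeal_eq.1 (isField_localization_of_mem_minimalPrimes hP),
      Ideal.mem_bot] at h3
  rw [h1] at h2
  exact mul_ne_zero (Finset.prod_ne_zero_iff.2 fun i _ =>
    (IsLocalization.map_units K (s i)).ne_zero) hr h2

/-- The determinant avoids every minimal prime, so over the field at `P` the columns of `Φ` are
independent; the embedding into `K ^ e` bounds the rank from above. -/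
theorem hasGenericRank_of_det [IsReduced R] {e : ℕ} {N : Submodule R (Fin e → R)}
    {Φ : Matrix (Fin e) (Fin e) R} (hΦ : ∀ j, Φ.col j ∈ N) (hdet : Φ.det ∈ R⁰) :
    HasGenericRank R N e := by
  intro P hprime hP
  let K := Localization P.primeCompl
  let : Field K := (isField_localization_of_mem_minimalPrimes hP).toField
  obtain ⟨j, hj, hjm⟩ := exists_localizedModule_embedding P.primeCompl N
  refine le_antisymm ?_ (Module.le_rank_iff.2
    ⟨fun i => LocalizedModule.mkLinearMap P.primeCompl N ⟨Φ.col i, hΦ i⟩, ?_⟩)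
  · have := LinearMap.rank_le_of_injective j hj
    simpa using this
  · refine LinearIndependent.of_comp j ?_
    have h1 : (j ∘ fun i => LocalizedModule.mkLinearMap P.primeCompl N ⟨Φ.col i, hΦ i⟩) =
        (Φ.map (algebraMap R K)).col := by
      funext i
      exact hjm _
    rw [h1]
    refine Matrix.linearIndependent_cols_of_det_ne_zero ?_
    have h2 : (Φ.map (algebraMap R K)).det = algebraMap R K Φ.det := (RingHom.map_det _ _).symm
    rw [h2]
    have h3 : Φ.det ∈ P.primeCompl := mem_nonZeroDivisors_iff_forall_minimalPrimes.1 hdet P hP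
    exact (IsLocalization.map_units K ⟨_, h3⟩).ne_zero

/-- Prime avoidance for the finitely many minimal primes, whose union is the set of zero divisors of
a reduced ring. -/
theorem exists_mem_nonZeroDivisors_of_forall_minimalPrimes [IsNoetherianRing R] [IsReduced R]
    {J : Ideal R} (hJ : ∀ P ∈ minimalPrimes R, ∃ x ∈ J, x ∉ P) : ∃ g ∈ R⁰, g ∈ J := by
  by_contra! hcon
  have h1 : (J : Set R) ⊆ ⋃ P ∈ minimalPrimes R, ((id P : Ideal R) : Set R) := by
    intro x hx
    by_contra hx'
    refine hcon x (mem_nonZeroDivisors_iff_forall_minimalPrimes.2 fun P hP hxP => hx' ?_) hx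
    exact Set.mem_biUnion hP hxP
  obtain ⟨P, hP, hJP⟩ := (Ideal.subset_union_prime_finite
    (minimalPrimes.finite_of_isNoetherianRing R) ⊥ ⊥ fun P hP _ _ => hP.1.1).1 h1
  obtain ⟨x, hx, hxP⟩ := hJ P hP
  exact hxP (hJP hx)

end GenericRank

/-! ### Equality of the two multiplicities -/

section CurveGerm

theorem LocalAnalyticRing.isCurveRing {n : ℕ} {I : Ideal (ConvergentPowerSeries n)}
    (hI : I.IsRadical) (hdim : ringKrullDim (LocalAnalyticRing n I) = 1) :
    IsCurveRing (LocalAnalyticRing n I) := by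
  have : Nontrivial (LocalAnalyticRing n I) := by
    rw [← not_subsingleton_iff_nontrivial]
    intro h
    rw [ringKrullDim_eq_bot_of_subsingleton] at hdim
    exact absurd hdim (by decide)
  have h1 := LocalAnalyticRing.isNoetherianRing n I
  have h2 := LocalAnalyticRing.isReduced hI
  have h3 := LocalAnalyticRing.isLocalRing I
  exact { ringKrullDim_eq_one := hdim
          exists_sub_mem := LocalAnalyticRing.exists_sub_mem }

open nonZeroDivisors in
theorem exists_multiplicity_of_hasGenericRank {R : Type*} [CommRing R] [Algebra ℂ R]
    [IsCurveRing R] {p e : ℕ} {M : Submodule R (Fin p → R)} (hM : HasGenericRank R M e) :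
    ∃ k : ℕ, IsHilbertSamuelMultiplicity 1 (fittingIdealOfQuotient M (p - e)) k ∧
      ForGenericMatrix fun A : Matrix (Fin e) (Fin p) ℂ =>
        HasGenericRank R (matrixImage A M) e ∧ IsBuchsbaumRimMultiplicity (matrixImage A M) k := by
  obtain ⟨P₀, hP₀⟩ : (minimalPrimes R).Nonempty :=
    Set.nonempty_coe_sort.1 (Ideal.nonempty_minimalPrimes bot_ne_top)
  -- The embedding at one minimal prime gives `e ≤ p`; otherwise truncated subtraction would not
  -- return `e`.
  have hep : p - (p - e) = e := Nat.sub_sub_self (hM.exists_minor_notMem hP₀).1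
  rw [fittingIdealOfQuotient, hep]
  have hnzd : ∃ g₀ ∈ R⁰, g₀ ∈ minorsIdeal M e :=
    exists_mem_nonZeroDivisors_of_forall_minimalPrimes fun P hP => (hM.exists_minor_notMem hP).2
  obtain ⟨c₀, X, hX⟩ : ∃ (c₀ : ℕ) (X : Matrix (Fin p) (Fin c₀) R),
      Submodule.span R (Set.range X.col) = M := by
    obtain ⟨c₀, s, hs⟩ := Submodule.fg_iff_exists_fin_generating_family.1
      (IsNoetherian.noetherian M)
    exact ⟨c₀, Matrix.of fun i j => s j i, hs⟩
  obtain ⟨P, B, c, hP, hc, hA⟩ := exists_generic_minor X _ (minorsIdeal_eq_span_range e M X hX) hnzd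
  let Φ : Matrix (Fin e) (Fin p) ℂ → Matrix (Fin e) (Fin e) R := fun A =>
    A.map (algebraMap ℂ R) * X * B.map (algebraMap ℂ R)
  have hΦ : ∀ A j, (Φ A).col j ∈ matrixImage A M := by
    intro A j
    have h1 : (Φ A).col j = (A.map (algebraMap ℂ R)).mulVec
        (X.mulVec ((B.map (algebraMap ℂ R)).col j)) := by
      simp only [Φ]
      rw [Matrix.mulVec_mulVec]
      rfl
    rw [h1]
    refine ⟨_, ?_, rfl⟩
    rw [← hX, ← Matrix.range_mulVecLin]
    exact ⟨_, rfl⟩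
  have hle : ∀ A : Matrix (Fin e) (Fin p) ℂ, minorsIdeal (matrixImage A M) e ≤ minorsIdeal M e :=
    fun A => minorsIdeal_map_mulVecLin_le _ M
  have hHS : ∀ A, MvPolynomial.eval (fun ij => A ij.1 ij.2) P ≠ 0 → ∃ k : ℕ,
      cokerLength (LinearMap.lsmul R R (Φ A).det) = k ∧
        IsHilbertSamuelMultiplicity 1 (minorsIdeal M e) k := by
    intro A hPA
    obtain ⟨k, hk⟩ := ENat.ne_top_iff_exists.1 (cokerLength_lsmul_ne_top (hA A hPA).1)
    exact ⟨k, hk.symm, isHilbertSamuelMultiplicity_of_reduction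
      (hle A (det_mem_minorsIdeal (hΦ A))) (hA A hPA).1 hc (hA A hPA).2 hk.symm⟩
  obtain ⟨x₀, hx₀⟩ : ∃ x, MvPolynomial.eval x P ≠ 0 := by
    by_contra! hcon
    exact hP (MvPolynomial.funext fun x => by rw [hcon x, map_zero])
  -- `k` is read off from one admissible matrix. For any other, the length of `R / (det Φ)` is again
  -- the Hilbert–Samuel multiplicity of the same ideal, so uniqueness identifies it with `k`.
  obtain ⟨k, -, hk⟩ := hHS (fun i j => x₀ (i, j)) hx₀
  refine ⟨k, hk, P, hP, fun A hPA => ⟨hasGenericRank_of_det (hΦ A) (hA A hPA).1, ?_⟩⟩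
  obtain ⟨k', hk', hHS'⟩ := hHS A hPA
  rw [hk.unique hHS']
  exact isBuchsbaumRimMultiplicity_of_reduction (hΦ A) (hA A hPA).1 hc
    (fun l x hx => (hA A hPA).2 l x (Ideal.pow_right_mono (hle A) l hx)) hk'

end CurveGerm

theorem proposition2p3 (n : ℕ) (I : Ideal (ConvergentPowerSeries n)) (hI : I.IsRadical)
    (hdim : ringKrullDim (LocalAnalyticRing n I) = 1) (p e : ℕ)
    (M : Submodule (LocalAnalyticRing n I) (Fin p → LocalAnalyticRing n I))
    (hM : HasGenericRank (LocalAnalyticRing n I) M e) :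
    ∃ k : ℕ, IsHilbertSamuelMultiplicity 1 (fittingIdealOfQuotient M (p - e)) k ∧
      ForGenericMatrix fun A : Matrix (Fin e) (Fin p) ℂ =>
        HasGenericRank (LocalAnalyticRing n I) (matrixImage A M) e ∧
        IsBuchsbaumRimMultiplicity (matrixImage A M) k := by
  have := LocalAnalyticRing.isCurveRing hI hdim
  exact exists_multiplicity_of_hasGenericRank hM
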